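/- Let $(M,\tau)$ be a tracial von Neumann algebra, i.e. a von Neumann algebra $M$ with a faithful normal tracial state $\tau$, and let $L^1(M,\tau)$ be the completion of $M$ for $\|a\|_1=\tau(|a|)$. Assume that the predual $L^1(M,\tau)$ is separable. Write $L^1(M,\tau)_+$ for the $\|\cdot\|_1$-closure of $M_+$ (with $x\le y$ meaning $y-x\in L^1(M,\tau)_+$), let $\tau(xa)$ ($x\in L^1(M,\tau)$, $a\in M$) be the continuous extension of the duality pairing, and put $$S=\{x\in L^1(M,\tau)_+:\tau(x)=1\},\qquad S_b=S\cap M.$$ For $x,y\in S$ let $m(x,y)=\max\{\lambda\in\mathbb R:\lambda y\le x\}$ and $d(x,y)=\frac{1-m(x,y)m(y,x)}{1+m(x,y)m(y,x)}$ (the Hennion metric). A positive linear map $\gamma$ on $L^1(M,\tau)$ is faithful if it sends no nonzero element of $L^1(M,\tau)_+$ to $0$; it then acts on $S$ by $\gamma\cdot x=\gamma(x)/\tau(\gamma(x))$, and it belongs to $SHC(M)$ (strict Hennion contractions) if moreover $$c(\gamma)=\sup_{x\ne y\in S}\frac{d(\gamma\cdot x,\gamma\cdot y)}{d(x,y)}<1$$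 (with $c(\gamma)=0$ if $S$ is a single point). Let $(\Omega,\mathbb P)$ be a probability space and $T$ an ergodic automorphism of it (a bimeasurable, measure preserving, ergodic bijection). Let $\phi\colon\Omega\times M\to M$ be a weak* random linear operator: $\omega\mapsto\tau(x\,\phi_\omega(a))$ is measurable for all $x\in L^1(M,\tau)$ and $a\in M$, and $\phi_\omega(\alpha a+b)=\alpha\phi_\omega(a)+\phi_\omega(b)$ almost surely for all $a,b\in M$ and $\alpha\in\mathbb C$. Assume that for almost every $\omega$ the map $\phi_\omega$ is linear, positive, normal and $\tau$-bounded (there is $c_\omega>0$ with $\tau(\phi_\omega(a))\le c_\omega\tau(a)$ for all $a\in M_+$), and that its unique bounded extension to $L^1(M,\tau)$, still denoted $\phi_\omega$, is faithful. For integers $n\ge m$ let $$\Phi_{n,m}(\omega)=\phi_{T^n\omega}\circ\phi_{T^{n-1}\omega}\circ\cdots\circ\phi_{T^m\omega}\quad\text{on } L^1(M,\tau),$$ and suppose that $$\mathbb P[\exists\, n,m\in\mathbb Z:\ n\ge m\text{ and }\Phi_{n,m}\in SHC(M)]>0.$$ Then there exists a family of random variables $A_n\colon\Omega\to S_b$,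 $n\in\mathbb Z$ (strongly measurable for $\|\cdot\|_1$), such that almost surely, for all $n\in\mathbb Z$, $$\phi_{T^{n+1}\omega}\cdot A_n(\omega)=A_{n+1}(\omega)\qquad\text{and}\qquad A_n(T^{\pm1}\omega)=A_{n\pm1}(\omega),$$ and such that for every $x\in S$, almost surely, for all $n\in\mathbb Z$, $$\lim_{m\to-\infty}\|\Phi_{n,m}\cdot x-A_n\|_1=0.$$ Moreover, for every $x\in S_b$ this convergence holds, almost surely for all $n\in\mathbb Z$, in the operator norm $\|\cdot\|_\infty$ of $M$. -/

import Mathlib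

namespace TracialVN

section generic

open scoped ComplexOrder

theorem re_apply_algebraMap {A : Type*} [CStarAlgebra A] [PartialOrder A] (f : A →ₚ[ℂ] ℂ) (ε : ℝ) :
    (f (algebraMap ℝ A ε)).re = ε * (f 1).re := by
  rw [Algebra.algebraMap_eq_smul_one, ← Complex.coe_smul, map_smul, smul_eq_mul,
    Complex.re_ofReal_mul]

variable {A : Type*} [CStarAlgebra A] [PartialOrder A] [StarOrderedRing A]

/-- Approximate polar decomposition `a = u (|a| + ε)` with a contraction `u`. -/
theorem exists_approx_polar (a : A) {ε : ℝ} (hε : 0 < ε) :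
    ∃ u : A, ‖u‖ ≤ 1 ∧ a = u * (CFC.abs a + algebraMap ℝ A ε) ∧
      CFC.abs a - algebraMap ℝ A ε ≤ star u * a := by
  set p := CFC.abs a with hp
  have hp0 : 0 ≤ p := CFC.abs_nonneg a
  have hpsa : IsSelfAdjoint p := IsSelfAdjoint.of_nonneg hp0
  have hpp : p * p = star a * a := CFC.abs_mul_abs a
  have hspec : ∀ t ∈ spectrum ℝ p, 0 ≤ t := fun t ht => spectrum_nonneg_of_nonneg hp0 ht
  have hcont : ContinuousOn (fun t : ℝ => (t + ε)⁻¹) (spectrum ℝ p) := by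
    refine ContinuousOn.inv₀ (by fun_prop) fun t ht => ?_
    have := hspec t ht
    positivity
  set g := cfc (fun t : ℝ => (t + ε)⁻¹) p with hg
  have hgsa : star g = g := (cfc_predicate (fun t : ℝ => (t + ε)⁻¹) p : IsSelfAdjoint g)
  have hadd : p + algebraMap ℝ A ε = cfc (fun t : ℝ => t + ε) p := by
    rw [cfc_add_const ε (fun t : ℝ => t) p, cfc_id' ℝ p]
  have hg1 : g * (p + algebraMap ℝ A ε) = 1 := by
    rw [hadd, hg, ← cfc_mul _ _ p hcont (by fun_prop), ← cfc_one ℝ p]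
    refine cfc_congr fun t ht => ?_
    have := hspec t ht
    have h2 : t + ε ≠ 0 := by positivity
    simp [h2]
  have hgp : g * p = cfc (fun t : ℝ => (t + ε)⁻¹ * t) p := by
    rw [cfc_mul (fun t : ℝ => (t + ε)⁻¹) (fun t => t) p hcont (by fun_prop), cfc_id' ℝ p]
  have hpg : p * g = cfc (fun t : ℝ => t * (t + ε)⁻¹) p := by
    rw [cfc_mul (fun t : ℝ => t) (fun t : ℝ => (t + ε)⁻¹) p (by fun_prop) hcont, cfc_id' ℝ p]
  refine ⟨a * g, ?_, ?_, ?_⟩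
  · have h1 : star (a * g) * (a * g) = (g * p) * (p * g) := by
      rw [star_mul, hgsa]
      calc g * star a * (a * g) = g * (star a * a) * g := by simp only [mul_assoc]
        _ = _ := by rw [← hpp]; simp only [mul_assoc]
    have h2 : (g * p) * (p * g) ≤ 1 := by
      rw [hgp, hpg, ← cfc_mul _ _ p (by fun_prop) (by fun_prop)]
      refine cfc_le_one _ _ fun t ht => ?_
      have h0 := hspec t ht
      have h3 : (t + ε)⁻¹ * t ≤ 1 := by
        rw [inv_mul_le_iff₀ (by positivity)]; linarith
      have h4 : 0 ≤ (t + ε)⁻¹ * t := by positivity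
      rw [mul_comm t]
      nlinarith
    have h3 : ‖star (a * g) * (a * g)‖ ≤ 1 :=
      (CStarAlgebra.norm_le_one_iff_of_nonneg _ (star_mul_self_nonneg _)).2 (h1 ▸ h2)
    rw [CStarRing.norm_star_mul_self] at h3
    nlinarith [norm_nonneg (a * g)]
  · rw [mul_assoc, hg1, mul_one]
  · rw [star_mul, hgsa, mul_assoc, ← hpp, ← mul_assoc, hgp]
    have hx : cfc (fun t : ℝ => (t + ε)⁻¹ * t) p * p
        = cfc (fun t : ℝ => (t + ε)⁻¹ * t * t) p := by
      rw [cfc_mul (fun t : ℝ => (t + ε)⁻¹ * t) (fun t => t) p (by fun_prop) (by fun_prop),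
        cfc_id' ℝ p]
    have hy : p - algebraMap ℝ A ε = cfc (fun t : ℝ => t - ε) p := by
      rw [cfc_sub (fun t : ℝ => t) (fun _ => ε) p, cfc_id' ℝ p, cfc_const ε p]
    rw [hx, hy]
    refine cfc_mono (fun t ht => ?_) (by fun_prop) (by fun_prop)
    have h0 := hspec t ht
    rw [mul_assoc, le_inv_mul_iff₀ (by positivity)]
    nlinarith

theorem norm_apply_mul_le_of_nonneg (f : A →ₚ[ℂ] ℂ) (htr : ∀ a b, f (a * b) = f (b * a))
    {q : A} (hq : 0 ≤ q) (c : A) : ‖f (q * c)‖ ≤ ‖c‖ * (f q).re := by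
  set s := CFC.sqrt q with hs
  have hss : s * s = q := CFC.sqrt_mul_sqrt_self q hq
  have hsa : star s = s := IsSelfAdjoint.of_nonneg (CFC.sqrt_nonneg q)
  have hfq : 0 ≤ f q := f.map_nonneg hq
  have h1 : f (q * c) = inner ℂ (f.toPreGNS s) (f.toPreGNS (s * c)) := by
    rw [PositiveLinearMap.preGNS_inner_def]
    simp [hsa, ← mul_assoc, hss]
  have h2 : ‖f.toPreGNS s‖ = √((f q).re) := by
    rw [PositiveLinearMap.preGNS_norm_def]; simp [hsa, hss]
  have h3 : ‖f.toPreGNS (s * c)‖ ≤ ‖c‖ * √((f q).re) := by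
    rw [PositiveLinearMap.preGNS_norm_def]
    refine Real.sqrt_le_iff.2 ⟨by positivity, ?_⟩
    rw [mul_pow, Real.sq_sqrt hfq.1]
    have e1 : f (star (s * c) * (s * c)) = f (s * (c * star c) * s) := by
      rw [star_mul, hsa]
      rw [show star c * s * (s * c) = (star c * s) * (s * c) from rfl, htr]
      simp only [mul_assoc]
    have e2 : s * (c * star c) * s ≤ ‖c * star c‖ • (s * s) := by
      have := CStarAlgebra.star_left_conjugate_le_norm_smul (a := s) (b := c * star c)
      rwa [hsa] at this
    have e3 := f.monotone' e2
    simp only [PositiveLinearMap.ofPreGNS_toPreGNS, e1]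
    have e4 := e3.1
    rw [CStarRing.norm_self_mul_star, hss] at e4
    have e5 : f ((‖c‖ * ‖c‖) • q) = ((‖c‖ * ‖c‖ : ℝ) : ℂ) * f q := by
      rw [← Complex.coe_smul, map_smul, smul_eq_mul]
    have e6 : (f ((‖c‖ * ‖c‖) • q)).re = ‖c‖ ^ 2 * (f q).re := by
      rw [e5, Complex.re_ofReal_mul, sq]
    exact e4.trans_eq e6
  rw [h1]
  calc _ ≤ ‖f.toPreGNS s‖ * ‖f.toPreGNS (s * c)‖ := norm_inner_le_norm _ _
    _ ≤ √((f q).re) * (‖c‖ * √((f q).re)) := by rw [h2]; gcongr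
    _ = ‖c‖ * (√((f q).re) * √((f q).re)) := by ring
    _ = _ := by rw [Real.mul_self_sqrt hfq.1]

/-- Hölder inequality `|f(ab)| ≤ ‖b‖ f(|a|)` for a positive tracial functional. -/
theorem norm_apply_mul_le (f : A →ₚ[ℂ] ℂ) (htr : ∀ a b, f (a * b) = f (b * a)) (a b : A) :
    ‖f (a * b)‖ ≤ ‖b‖ * (f (CFC.abs a)).re := by
  have h1 : 0 ≤ (f 1).re := (f.map_nonneg zero_le_one).1
  have key : ∀ ε : ℝ, 0 < ε → ‖f (a * b)‖ ≤ ‖b‖ * ((f (CFC.abs a)).re + ε * (f 1).re) := by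
    intro ε hε
    obtain ⟨u, hu, hau, -⟩ := exists_approx_polar a hε
    have hq : 0 ≤ CFC.abs a + algebraMap ℝ A ε :=
      add_nonneg (CFC.abs_nonneg a) (algebraMap_nonneg A hε.le)
    have hfq : 0 ≤ (f (CFC.abs a + algebraMap ℝ A ε)).re := (f.map_nonneg hq).1
    have e : f (a * b) = f ((CFC.abs a + algebraMap ℝ A ε) * (b * u)) := by
      conv_lhs => rw [hau, mul_assoc, htr, mul_assoc]
    rw [e]
    refine (norm_apply_mul_le_of_nonneg f htr hq _).trans ?_
    have hbu : ‖b * u‖ ≤ ‖b‖ := (norm_mul_le _ _).trans (mul_le_of_le_one_right (norm_nonneg _) hu)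
    refine (mul_le_mul_of_nonneg_right hbu hfq).trans_eq ?_
    rw [map_add, Complex.add_re, re_apply_algebraMap]
  refine le_of_forall_pos_le_add fun δ hδ => ?_
  have hc : 0 < ‖b‖ * (f 1).re + 1 := by positivity
  refine (key (δ / (‖b‖ * (f 1).re + 1)) (by positivity)).trans ?_
  have : δ / (‖b‖ * (f 1).re + 1) * (‖b‖ * (f 1).re) ≤ δ := by
    rw [div_mul_eq_mul_div, div_le_iff₀ hc]; nlinarith
  nlinarith

/-- Triangle inequality for `a ↦ f(|a|)`. -/
theorem abs_add_le (f : A →ₚ[ℂ] ℂ) (htr : ∀ a b, f (a * b) = f (b * a)) (a b : A) :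
    (f (CFC.abs (a + b))).re ≤ (f (CFC.abs a)).re + (f (CFC.abs b)).re := by
  have h1 : 0 ≤ (f 1).re := (f.map_nonneg zero_le_one).1
  have hn : ∀ x : A, 0 ≤ (f (CFC.abs x)).re := fun x => (f.map_nonneg (CFC.abs_nonneg x)).1
  have key : ∀ ε : ℝ, 0 < ε → (f (CFC.abs (a + b))).re ≤
      (f (CFC.abs a)).re + (f (CFC.abs b)).re + ε * (f 1).re := by
    intro ε hε
    obtain ⟨u, hu, -, hle⟩ := exists_approx_polar (a + b) hε
    have e1 := (f.monotone' hle).1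
    have e2 : f (star u * (a + b)) = f (a * star u) + f (b * star u) := by
      rw [mul_add, map_add, htr _ a, htr _ b]
    have e3 : ∀ x : A, (f (x * star u)).re ≤ (f (CFC.abs x)).re := fun x =>
      (Complex.re_le_norm _).trans ((norm_apply_mul_le f htr x _).trans
        (mul_le_of_le_one_left (hn x) (by rwa [norm_star])))
    have e4 : (f (CFC.abs (a + b) - algebraMap ℝ A ε)).re =
        (f (CFC.abs (a + b))).re - ε * (f 1).re := by
      rw [map_sub, Complex.sub_re, re_apply_algebraMap]
    have e5 : (f (CFC.abs (a + b) - algebraMap ℝ A ε)).re ≤ (f (star u * (a + b))).re := e1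
    rw [e2, e4, Complex.add_re] at e5
    linarith [e3 a, e3 b]
  refine le_of_forall_pos_le_add fun δ hδ => ?_
  refine (key (δ / ((f 1).re + 1)) (by positivity)).trans ?_
  have : δ / ((f 1).re + 1) * (f 1).re ≤ δ := by
    rw [div_mul_eq_mul_div, div_le_iff₀ (by positivity)]; nlinarith
  linarith

end generic

section vonNeumann

variable {H : Type*} [NormedAddCommGroup H] [InnerProductSpace ℂ H] [CompleteSpace H]

instance instSMulMemClass : SMulMemClass (VonNeumannAlgebra H) ℂ (H →L[ℂ] H) where
  smul_mem {M} c _ ha := M.toStarSubalgebra.smul_mem ha c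

theorem isClosed_coe (M : VonNeumannAlgebra H) : IsClosed (M : Set (H →L[ℂ] H)) := by
  rw [← M.centralizer_centralizer]
  exact Set.isClosed_centralizer _

/-- A von Neumann algebra on `H` is a C⋆-algebra for the operations and the operator norm
inherited from `B(H)`. -/
noncomputable instance instCStarAlgebra (M : VonNeumannAlgebra H) : CStarAlgebra M :=
  haveI : IsClosed (M : Set (H →L[ℂ] H)) := isClosed_coe M
  StarSubalgebra.cstarAlgebra M

/-- The order on `M` inherited from `B(H)` (`a ≤ b` iff `b - a` is a positive semidefinite
operator) is the order whose positive elements are the `star s * s`, `s ∈ M`. -/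
instance instStarOrderedRing (M : VonNeumannAlgebra H) : StarOrderedRing M := by
  have : IsClosed (M : Set (H →L[ℂ] H)) := isClosed_coe M
  refine StarOrderedRing.of_nonneg_iff' (fun {x y} h z => ?_) fun x => ⟨fun h => ?_, ?_⟩
  · exact add_le_add_right (α := H →L[ℂ] H) h z
  · have hx : (0 : H →L[ℂ] H) ≤ x := h
    have hmem : CFC.sqrt (x : H →L[ℂ] H) ∈ M := by
      rw [CFC.sqrt_eq_real_sqrt _ hx]
      exact cfcₙ_mem (𝕜' := ℂ) (s := M) _ x.2
    refine ⟨⟨_, hmem⟩, Subtype.ext ?_⟩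
    have hsa : star (CFC.sqrt (x : H →L[ℂ] H)) = CFC.sqrt (x : H →L[ℂ] H) :=
      IsSelfAdjoint.of_nonneg (CFC.sqrt_nonneg _)
    change (x : H →L[ℂ] H) = star (CFC.sqrt (x : H →L[ℂ] H)) * CFC.sqrt (x : H →L[ℂ] H)
    rw [hsa, CFC.sqrt_mul_sqrt_self _ hx]
  · rintro ⟨s, rfl⟩
    exact star_mul_self_nonneg (s : H →L[ℂ] H)

/-- The σ-weak operator topology (weak* topology) on `M`: the coarsest topology for which all
functionals `a ↦ ∑ n, ⟪ξ n, a (η n)⟫` with `∑ ‖ξ n‖² < ∞` and `∑ ‖η n‖² < ∞` are continuous. -/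
@[reducible]
noncomputable def sigmaWOT (M : VonNeumannAlgebra H) : TopologicalSpace M :=
  ⨅ (ξ : ℕ → H) (η : ℕ → H) (_ : Summable fun n => ‖ξ n‖ ^ 2) (_ : Summable fun n => ‖η n‖ ^ 2),
    TopologicalSpace.induced
      (fun a : M => ∑' n, inner ℂ (ξ n) ((a : H →L[ℂ] H) (η n))) inferInstance

open scoped ComplexOrder in
/-- A faithful normal tracial state on the von Neumann algebra `M`. -/
structure TracialState (M : VonNeumannAlgebra H) where
  /-- the underlying linear functional -/
  toLinearMap : M →ₗ[ℂ] ℂ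
  nonneg' : ∀ a : M, 0 ≤ a → 0 ≤ toLinearMap a
  map_one' : toLinearMap 1 = 1
  map_mul_comm' : ∀ a b : M, toLinearMap (a * b) = toLinearMap (b * a)
  faithful' : ∀ a : M, 0 ≤ a → toLinearMap a = 0 → a = 0
  normal' : @Continuous M ℂ (sigmaWOT M) inferInstance toLinearMap

variable {M : VonNeumannAlgebra H}

noncomputable instance : CoeFun (TracialState M) (fun _ => M → ℂ) := ⟨fun τ => τ.toLinearMap⟩

open scoped ComplexOrder in
/-- A tracial state as a bundled positive linear map. -/
noncomputable def TracialState.toPositive (τ : TracialState M) : M →ₚ[ℂ] ℂ :=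
  PositiveLinearMap.mk₀ τ.toLinearMap τ.nonneg'

/-- The algebra `M`, to be equipped with the norm `‖a‖₁ = τ(|a|)`. -/
@[nolint unusedArguments]
def PreL1 (_τ : TracialState M) : Type _ := M

variable (τ : TracialState M)

noncomputable instance : AddCommGroup (PreL1 τ) := inferInstanceAs (AddCommGroup M)
noncomputable instance : Module ℂ (PreL1 τ) := inferInstanceAs (Module ℂ M)

/-- The identity map from `M` to `M` with the `1`-norm. -/
noncomputable def toPreL1 : M ≃ₗ[ℂ] PreL1 τ := LinearEquiv.refl ℂ _

/-- `‖a‖₁ = τ(|a|)`, where `|a| = (a⋆a)^{1/2}`. -/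
noncomputable instance : Norm (PreL1 τ) :=
  ⟨fun a => (τ (CFC.abs ((toPreL1 τ).symm a))).re⟩

theorem preL1_core : NormedSpace.Core ℂ (PreL1 τ) where
  norm_nonneg x := (τ.nonneg' _ (CFC.abs_nonneg ((toPreL1 τ).symm x))).1
  norm_smul c x := by
    change (τ (CFC.abs ((toPreL1 τ).symm (c • x)))).re = ‖c‖ * (τ (CFC.abs ((toPreL1 τ).symm x))).re
    rw [map_smul, CFC.abs_smul, ← Complex.coe_smul, map_smul, smul_eq_mul, Complex.re_ofReal_mul]
  norm_triangle x y := abs_add_le τ.toPositive τ.map_mul_comm' _ _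
  norm_eq_zero_iff x := by
    have h0 := τ.nonneg' _ (CFC.abs_nonneg ((toPreL1 τ).symm x))
    constructor
    · intro h
      have h1 : τ (CFC.abs ((toPreL1 τ).symm x)) = 0 := Complex.ext h h0.2.symm
      have h2 := τ.faithful' _ (CFC.abs_nonneg _) h1
      rw [CFC.abs_eq_zero_iff] at h2
      simpa using h2
    · rintro rfl
      change (τ (CFC.abs ((toPreL1 τ).symm 0))).re = 0
      simp

noncomputable instance : NormedAddCommGroup (PreL1 τ) := NormedAddCommGroup.ofCore (preL1_core τ)
noncomputable instance : NormedSpace ℂ (PreL1 τ) := NormedSpace.ofCore (preL1_core τ)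

/-- `L¹(M, τ)`: the completion of `M` for the norm `‖a‖₁ = τ(|a|)`. -/
abbrev L1 : Type _ := UniformSpace.Completion (PreL1 τ)

/-- The canonical embedding `M → L¹(M, τ)`. -/
noncomputable def ofM : M →ₗ[ℂ] L1 τ :=
  (UniformSpace.Completion.toComplL (𝕜 := ℂ) (E := PreL1 τ)).toLinearMap ∘ₗ (toPreL1 τ).toLinearMap

/-- The bilinear form `(x, a) ↦ τ(x a)` on `M × M`, bounded by `‖x‖₁ ‖a‖`. -/
noncomputable def prePairing : PreL1 τ →L[ℂ] M →L[ℂ] ℂ :=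
  LinearMap.mkContinuous₂
    (((LinearMap.mul ℂ M).compr₂ τ.toLinearMap) ∘ₗ (toPreL1 τ).symm.toLinearMap) 1
    fun x a => by
      rw [one_mul, mul_comm]
      exact norm_apply_mul_le τ.toPositive τ.map_mul_comm' ((toPreL1 τ).symm x) a

/-- The duality pairing `(x, a) ↦ τ(x a)` for `x ∈ L¹(M, τ)` and `a ∈ M`, extended by continuity
from `x ∈ M`. -/
noncomputable def pairing : L1 τ →L[ℂ] M →L[ℂ] ℂ := (prePairing τ).fromCompletion

theorem pairing_ofM (b a : M) : pairing τ (ofM τ b) a = τ (b * a) :=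
  congrArg (fun l : M →L[ℂ] ℂ => l a) ((prePairing τ).fromCompletion_apply_coe (toPreL1 τ b))

/-- The extension of the trace to `L¹(M, τ)`. -/
noncomputable def tr (x : L1 τ) : ℂ := pairing τ x 1

/-- The positive cone `L¹(M, τ)₊`, the `‖·‖₁`-closure of `M₊`. -/
def posCone : Set (L1 τ) := closure (ofM τ '' {a : M | 0 ≤ a})

/-- The normal state space `S = {x ∈ L¹(M, τ)₊ | τ(x) = 1}`. -/
def states : Set (L1 τ) := {x | x ∈ posCone τ ∧ tr τ x = 1}

/-- The bounded states `S_b = S ∩ M`. -/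
def boundedStates : Set (L1 τ) := states τ ∩ Set.range (ofM τ)

/-- The operator norm on `L¹(M, τ)`: it is `‖a‖` for (the image of) `a ∈ M`, and `∞` off `M`. -/
noncomputable def opNorm (x : L1 τ) : ENNReal := ⨅ a : {a : M // ofM τ a = x}, ‖(a : M)‖ₑ

/-- `m(x, y) = max {l ∈ ℝ | l y ≤ x}`. -/
noncomputable def mQuantity (x y : L1 τ) : ℝ := sSup {l : ℝ | x - (l : ℂ) • y ∈ posCone τ}

/-- The Hennion metric on states. -/
noncomputable def hennionDist (x y : L1 τ) : ℝ :=
  (1 - mQuantity τ x y * mQuantity τ y x) / (1 + mQuantity τ x y * mQuantity τ y x)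

/-- Positivity of a linear map on `L¹(M, τ)`. -/
def IsPositiveL1 (γ : L1 τ →ₗ[ℂ] L1 τ) : Prop := ∀ x ∈ posCone τ, γ x ∈ posCone τ

/-- Faithfulness of a linear map on `L¹(M, τ)`: no nonzero positive element is sent to `0`. -/
def IsFaithfulL1 (γ : L1 τ →ₗ[ℂ] L1 τ) : Prop := ∀ x ∈ posCone τ, γ x = 0 → x = 0

/-- The projective action `γ · x = τ(γ(x))⁻¹ γ(x)`. -/
noncomputable def proj (γ : L1 τ →ₗ[ℂ] L1 τ) (x : L1 τ) : L1 τ := (tr τ (γ x))⁻¹ • γ x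

/-- The Hennion contraction constant: the supremum of `d(γ · x, γ · y) / d(x, y)` over distinct
states `x, y`. -/
noncomputable def contractionConst (γ : L1 τ →ₗ[ℂ] L1 τ) : ℝ :=
  sSup {r : ℝ | ∃ x ∈ states τ, ∃ y ∈ states τ, x ≠ y ∧
    r = hennionDist τ (proj τ γ x) (proj τ γ y) / hennionDist τ x y}

/-- `γ ∈ SHC(M)`: a faithful positive linear map on `L¹(M, τ)` with contraction constant `< 1`. -/
def IsSHC (γ : L1 τ →ₗ[ℂ] L1 τ) : Prop :=
  IsPositiveL1 τ γ ∧ IsFaithfulL1 τ γ ∧ contractionConst τ γ < 1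

/-- `f : M → M` is a `τ`-bounded normal positive linear map. -/
structure IsTauBoundedNormalPositive (f : M → M) : Prop where
  linear : IsLinearMap ℂ f
  nonneg : ∀ a : M, 0 ≤ a → 0 ≤ f a
  normal : @Continuous M M (sigmaWOT M) (sigmaWOT M) f
  tau_bounded : ∃ c : ℝ, 0 < c ∧ ∀ a : M, 0 ≤ a → (τ (f a)).re ≤ c * (τ a).re

open Classical in
/-- The extension of `f : M → M` to a bounded linear map on `L¹(M, τ)` (and `0` when there is no
such extension). -/
noncomputable def extendL1 (f : M → M) : L1 τ →L[ℂ] L1 τ :=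
  if h : ∃ g : L1 τ →L[ℂ] L1 τ, ∀ a : M, g (ofM τ a) = ofM τ (f a) then h.choose else 0

theorem denseRange_ofM : DenseRange (ofM τ) :=
  (UniformSpace.Completion.denseRange_coe (α := PreL1 τ)).comp
    (toPreL1 τ).surjective.denseRange (UniformSpace.Completion.continuous_coe _)

/-- The bounded extension is unique, so `extendL1 f` is it whenever it exists. -/
theorem extendL1_eq {f : M → M} {g : L1 τ →L[ℂ] L1 τ} (hg : ∀ a : M, g (ofM τ a) = ofM τ (f a)) :
    extendL1 τ f = g := by
  have h : ∃ g : L1 τ →L[ℂ] L1 τ, ∀ a : M, g (ofM τ a) = ofM τ (f a) := ⟨g, hg⟩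
  rw [extendL1, dif_pos h]
  refine ContinuousLinearMap.coeFn_injective
    ((denseRange_ofM τ).equalizer h.choose.continuous g.continuous ?_)
  funext a
  simp only [Function.comp_apply, h.choose_spec a, hg a]

end vonNeumann

section random

open MeasureTheory

variable {H : Type*} [NormedAddCommGroup H] [InnerProductSpace ℂ H] [CompleteSpace H]
  {M : VonNeumannAlgebra H} (τ : TracialState M) {Ω : Type*} [MeasurableSpace Ω]

/-- `φ : Ω → M → M` is a weak* random linear operator: `ω ↦ τ(φ_ω(a) x)` is measurable for all
`a ∈ M` and `x ∈ L¹(M, τ)`, and linearity holds almost surely. -/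
structure IsWeakStarRandomLinearOperator (P : Measure Ω) (φ : Ω → M → M) : Prop where
  measurable : ∀ (a : M) (x : L1 τ), Measurable fun ω => pairing τ x (φ ω a)
  linear : ∀ (α : ℂ) (a b : M), ∀ᵐ ω ∂P, φ ω (α • a + b) = α • φ ω a + φ ω b

/-- `γ_{T^{m+k} ω} ∘ ⋯ ∘ γ_{T^m ω}`. -/
noncomputable def iterComp {τ : TracialState M} (γ : Ω → L1 τ →L[ℂ] L1 τ) (T : Ω ≃ᵐ Ω) (m : ℤ) :
    ℕ → Ω → L1 τ →L[ℂ] L1 τ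
  | 0, ω => γ ((T.toEquiv ^ m : Equiv.Perm Ω) ω)
  | k + 1, ω => (γ ((T.toEquiv ^ (m + (k + 1 : ℕ)) : Equiv.Perm Ω) ω)).comp (iterComp γ T m k ω)

/-- The interval quantum process `Φ_{n,m}(ω) = φ_{T^n ω} ∘ ⋯ ∘ φ_{T^m ω}` on `L¹(M, τ)`, `m ≤ n`,
each `φ_ω` being extended to `L¹(M, τ)`. -/
noncomputable def process (φ : Ω → M → M) (T : Ω ≃ᵐ Ω) (n m : ℤ) (ω : Ω) : L1 τ →L[ℂ] L1 τ :=
  iterComp (fun ω => extendL1 τ (φ ω)) T m (n - m).toNat ω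

end random

end TracialVN

/-! This is a Birkhoff–Hopf contraction argument in the cone `L¹(M, τ)₊`. For a strict Hennion
contraction `γ` there is a constant `c` with `γ · x ≤ c (γ · y)` for all states `x`, `y`
(`exists_isProjBounded_of_isSHC`). This projective boundedness is all that is kept of the Hennion
metric. Its other half is `IsOscBounded.contract`: if images under `Γ` are comparable up to a factor
`1 + R`, those under `γ ∘ Γ` are comparable up to `1 + (1 - c⁻¹) R`.

Unlike membership in `SHC(M)`, whose measurability is never needed, projective boundedness with
fixed `c` can be tested on a countable dense set, so it is a null-measurable event. The hypothesis
puts a non-null set inside a countable union of translates of such events, so one block length and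
one constant already have positive probability. Poincaré recurrence and ergodicity make this block
reappear arbitrarily far in the past along almost every orbit (`exists_ae_recurring_block`). Hence
all states `Φ_{n,m} · x` become comparable up to `1 + ε`, uniformly in `x` and in all sufficiently
negative `m`.

Comparability up to `1 + ε` gives `‖·‖₁`-distance at most `2 ε` between states. Between elements of
`M` it is an operator inequality, which first bounds the operator norms and then makes the orbit of
`1` Cauchy in `M`. So the limit exists, lies in `S_b`, and attracts every state in `‖·‖₁` and every
bounded state in operator norm (`exists_tendsto_intervalComp`). Equivariance is uniqueness of
limits, and measurability passes to the limit after Pettis' theorem. -/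

namespace TracialVN

/-! ### The positive cone of `L¹(M, τ)`: trace, norm and order. -/

section order

open Filter Topology
open scoped ComplexOrder

variable {H : Type*} [NormedAddCommGroup H] [InnerProductSpace ℂ H] [CompleteSpace H]
  {M : VonNeumannAlgebra H} (τ : TracialState M)

theorem norm_ofM (a : M) : ‖ofM τ a‖ = (τ (CFC.abs a)).re :=
  UniformSpace.Completion.norm_coe (toPreL1 τ a)

theorem tracialState_re_le {a b : M} (h : a ≤ b) : (τ a).re ≤ (τ b).re :=
  (τ.toPositive.monotone' h).1

theorem norm_ofM_le (a : M) : ‖ofM τ a‖ ≤ ‖a‖ := by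
  have h1 := tracialState_re_le τ
    (IsSelfAdjoint.le_algebraMap_norm_self (IsSelfAdjoint.of_nonneg (CFC.abs_nonneg a)))
  rw [norm_ofM]
  refine h1.trans_eq ?_
  rw [CFC.norm_abs]
  refine (re_apply_algebraMap τ.toPositive ‖a‖).trans ?_
  change ‖a‖ * (τ 1).re = _
  rw [τ.map_one']
  simp

theorem norm_pairing_le (x : L1 τ) (a : M) : ‖pairing τ x a‖ ≤ ‖x‖ * ‖a‖ := by
  refine (denseRange_ofM τ).induction_on
    (p := fun x => ‖pairing τ x a‖ ≤ ‖x‖ * ‖a‖) x ?_ fun b => ?_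
  · exact isClosed_le (by fun_prop) (by fun_prop)
  · rw [pairing_ofM, norm_ofM, mul_comm]
    exact norm_apply_mul_le τ.toPositive τ.map_mul_comm' b a

theorem tr_ofM (a : M) : tr τ (ofM τ a) = τ a := by
  rw [tr, pairing_ofM, mul_one]

theorem continuous_tr : Continuous (tr τ) := by
  unfold tr; fun_prop

theorem tr_sub (x y : L1 τ) : tr τ (x - y) = tr τ x - tr τ y := by simp [tr]

theorem tr_smul (c : ℂ) (x : L1 τ) : tr τ (c • x) = c * tr τ x := by simp [tr]

theorem isClosed_posCone : IsClosed (posCone τ) := isClosed_closure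

variable {τ}

theorem ofM_mem_posCone {a : M} (ha : 0 ≤ a) : ofM τ a ∈ posCone τ :=
  subset_closure ⟨a, ha, rfl⟩

/-- A closed condition valid on `M₊` is valid on `L¹(M, τ)₊`. -/
theorem posCone_induction {p : L1 τ → Prop} (hp : IsClosed {x | p x})
    (h : ∀ a : M, 0 ≤ a → p (ofM τ a)) {x : L1 τ} (hx : x ∈ posCone τ) : p x := by
  refine closure_minimal ?_ hp hx
  rintro _ ⟨a, ha, rfl⟩
  exact h a ha

/-- On `M₊` one has `|a| = a`, and both sides are continuous. So the norm is additive on the cone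
and every normalizing factor is a positive real. -/
theorem tr_eq_norm {x : L1 τ} (hx : x ∈ posCone τ) : tr τ x = ‖x‖ := by
  refine posCone_induction (p := fun x => tr τ x = ‖x‖)
    (isClosed_eq (continuous_tr τ) (by fun_prop)) (fun a ha => ?_) hx
  rw [tr_ofM, norm_ofM, CFC.abs_of_nonneg a ha]
  have := τ.nonneg' a ha
  exact Complex.ext rfl this.2.symm

theorem add_mem_posCone {x y : L1 τ} (hx : x ∈ posCone τ) (hy : y ∈ posCone τ) :
    x + y ∈ posCone τ := by
  refine posCone_induction (p := fun x => x + y ∈ posCone τ)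
    ((isClosed_posCone τ).preimage (continuous_id.add continuous_const)) (fun a ha => ?_) hx
  refine posCone_induction (p := fun y => ofM τ a + y ∈ posCone τ)
    ((isClosed_posCone τ).preimage (continuous_const.add continuous_id)) (fun b hb => ?_) hy
  rw [← map_add]
  exact ofM_mem_posCone (add_nonneg ha hb)

theorem smul_mem_posCone {r : ℝ} (hr : 0 ≤ r) {x : L1 τ} (hx : x ∈ posCone τ) :
    (r : ℂ) • x ∈ posCone τ := by
  refine posCone_induction (p := fun x => (r : ℂ) • x ∈ posCone τ)
    ((isClosed_posCone τ).preimage (continuous_const_smul (r : ℂ))) (fun a ha => ?_) hx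
  rw [← map_smul, Complex.coe_smul]
  exact ofM_mem_posCone (smul_nonneg hr ha)

theorem zero_mem_posCone : (0 : L1 τ) ∈ posCone τ := by
  simpa using ofM_mem_posCone (τ := τ) le_rfl

theorem ofM_one_mem_boundedStates : ofM τ 1 ∈ boundedStates τ :=
  ⟨⟨ofM_mem_posCone zero_le_one, by rw [tr_ofM, τ.map_one']⟩, 1, rfl⟩

theorem norm_eq_one_of_mem_states {x : L1 τ} (hx : x ∈ states τ) : ‖x‖ = 1 := by
  have := tr_eq_norm hx.1
  rw [hx.2] at this
  exact_mod_cast this.symm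

theorem ne_zero_of_mem_states {x : L1 τ} (hx : x ∈ states τ) : x ≠ 0 := by
  rw [← norm_pos_iff, norm_eq_one_of_mem_states hx]
  exact one_pos

/-- Normalizing a nonzero positive element gives a state. -/
theorem normalize_mem_states {x : L1 τ} (hx : x ∈ posCone τ) (h0 : x ≠ 0) :
    (tr τ x)⁻¹ • x ∈ states τ := by
  have hn : (‖x‖ : ℂ) ≠ 0 := by simpa using h0
  refine ⟨?_, ?_⟩
  · rw [tr_eq_norm hx, ← Complex.ofReal_inv]
    exact smul_mem_posCone (by positivity) hx
  · rw [tr_smul, tr_eq_norm hx, inv_mul_cancel₀ hn]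

/-- For `a ∈ M₊` traciality gives `τ(a b) = τ(√b a √b)`; the condition is closed in `x`. -/
theorem pairing_nonneg {x : L1 τ} (hx : x ∈ posCone τ) {b : M} (hb : 0 ≤ b) :
    0 ≤ (pairing τ x b).re ∧ (pairing τ x b).im = 0 := by
  refine posCone_induction (p := fun x => 0 ≤ (pairing τ x b).re ∧ (pairing τ x b).im = 0)
    ?_ (fun a ha => ?_) hx
  · have hc : Continuous fun x : L1 τ => pairing τ x b := by fun_prop
    exact (isClosed_le continuous_const (Complex.continuous_re.comp hc)).inter
      (isClosed_eq (Complex.continuous_im.comp hc) continuous_const)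
  · set s := CFC.sqrt b
    have hss : s * s = b := CFC.sqrt_mul_sqrt_self b hb
    have hsa : star s = s := IsSelfAdjoint.of_nonneg (CFC.sqrt_nonneg b)
    have h1 : 0 ≤ s * a * s := by
      have := star_left_conjugate_nonneg ha s
      rwa [hsa] at this
    have h2 : τ (a * b) = τ (s * a * s) := by
      rw [← hss, ← mul_assoc, τ.map_mul_comm', mul_assoc]
    rw [pairing_ofM, h2]
    exact ⟨(τ.nonneg' _ h1).1, (τ.nonneg' _ h1).2.symm⟩

theorem tracialState_star (a : M) : τ (star a) = star (τ a) := map_star τ.toPositive a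

/-- Taking the `‖·‖₁`-closure adds no new positive elements inside `M`: by duality `τ(a b) ≥ 0` for
all `b ≥ 0`, and well-chosen `b` together with faithfulness of `τ` force `a ≥ 0`. This turns `L¹`
inequalities into operator inequalities. -/
theorem nonneg_of_ofM_mem_posCone {a : M} (ha : ofM τ a ∈ posCone τ) : 0 ≤ a := by
  have hp : ∀ b : M, 0 ≤ b → 0 ≤ (τ (a * b)).re ∧ (τ (a * b)).im = 0 := fun b hb => by
    rw [← pairing_ofM]; exact pairing_nonneg ha hb
  have hfaith : ∀ c : M, τ (star c * c) = 0 → c = 0 := fun c hc =>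
    (CStarRing.star_mul_self_eq_zero_iff c).1 (τ.faithful' _ (star_mul_self_nonneg c) hc)
  have hsa : IsSelfAdjoint a := by
    set d := a - star a with hd
    have h1 : ∀ b : M, 0 ≤ b → τ (d * b) = 0 := fun b hb => by
      have hbs : star b = b := IsSelfAdjoint.of_nonneg hb
      have h2 : τ (star a * b) = star (τ (a * b)) := by
        rw [← tracialState_star, star_mul, hbs, τ.map_mul_comm']
      rw [hd, sub_mul, map_sub, h2]
      refine Complex.ext ?_ ?_
      · simp
      · simp [(hp b hb).2]
    have h3 : ∀ b : M, IsSelfAdjoint b → τ (d * b) = 0 := fun b hb => by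
      rw [← CFC.posPart_sub_negPart b hb, mul_sub, map_sub, h1 _ (CFC.posPart_nonneg b),
        h1 _ (CFC.negPart_nonneg b), sub_zero]
    have h4 : τ (star d * d) = 0 := by
      -- `d` is skew-adjoint, so this multiple of `star d` is an admissible self-adjoint test
      -- element.
      have hid : IsSelfAdjoint (Complex.I • star d) := by
        rw [IsSelfAdjoint, star_smul, star_star, hd]
        simp [smul_sub, neg_add_eq_sub]
      have h5 := h3 _ hid
      rw [mul_smul_comm, map_smul, smul_eq_mul] at h5
      rw [τ.map_mul_comm']
      simpa using h5
    have h6 := hfaith d h4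
    rw [hd, sub_eq_zero] at h6
    exact h6.symm
  -- Testing against `a⁻` gives `0 ≤ τ(a a⁻) = -τ((a⁻)²)`.
  have hneg : a⁻ = 0 := by
    have h1 := (hp _ (CFC.negPart_nonneg a)).1
    have h2 : a * a⁻ = -(star a⁻ * a⁻) := by
      have hs : star a⁻ = a⁻ := IsSelfAdjoint.of_nonneg (CFC.negPart_nonneg a)
      refine (congrArg (· * a⁻) (CFC.posPart_sub_negPart a hsa).symm).trans ?_
      change (a⁺ - a⁻) * a⁻ = _
      rw [sub_mul, hs, CFC.posPart_mul_negPart, zero_sub]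
    rw [h2, map_neg] at h1
    have h3 := τ.nonneg' _ (star_mul_self_nonneg a⁻)
    refine hfaith _ (Complex.ext ?_ h3.2.symm)
    have h4 := h3.1
    simp only [Complex.neg_re, Complex.zero_re] at *
    linarith
  rw [← CFC.posPart_sub_negPart a hsa, hneg, sub_zero]
  exact CFC.posPart_nonneg a

theorem ofM_mem_posCone_iff {a : M} : ofM τ a ∈ posCone τ ↔ 0 ≤ a :=
  ⟨nonneg_of_ofM_mem_posCone, ofM_mem_posCone⟩

/-- The order bounds give `-ε a ≤ a - b ≤ ε b`, hence the spectrum of `a - b` lies in `[-ε K, ε K]`.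
-/
theorem norm_sub_le_of_order {a b : M} (ha : 0 ≤ a) (hb : 0 ≤ b) {ε K : ℝ} (hε : 0 ≤ ε)
    (haK : ‖a‖ ≤ K) (hbK : ‖b‖ ≤ K)
    (h1 : a ≤ (1 + ε) • b) (h2 : b ≤ (1 + ε) • a) : ‖a - b‖ ≤ ε * K := by
  have hK : 0 ≤ K := (norm_nonneg a).trans haK
  have hbd : ∀ c : M, 0 ≤ c → ‖c‖ ≤ K → ε • c ≤ algebraMap ℝ M (ε * K) := fun c hc hcK => by
    have h3 : c ≤ algebraMap ℝ M K := (CStarAlgebra.norm_le_iff_le_algebraMap c hK hc).1 hcK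
    rw [map_mul, ← Algebra.smul_def]
    exact smul_le_smul_of_nonneg_left h3 hε
  have hsa : IsSelfAdjoint (a - b) := (IsSelfAdjoint.of_nonneg ha).sub (IsSelfAdjoint.of_nonneg hb)
  have h3 : a - b ≤ algebraMap ℝ M (ε * K) := by
    refine le_trans ?_ (hbd b hb hbK)
    rw [sub_le_iff_le_add]
    refine h1.trans_eq ?_
    module
  have h4 : -algebraMap ℝ M (ε * K) ≤ a - b := by
    refine (neg_le_neg (hbd a ha haK)).trans ?_
    rw [neg_le, neg_sub, sub_le_iff_le_add]
    refine h2.trans_eq ?_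
    module
  rw [← cfc_id ℝ (a - b) hsa]
  refine norm_cfc_le (by positivity) fun t ht => abs_le.2 ⟨?_, ?_⟩
  · rw [← map_neg] at h4
    exact (algebraMap_le_iff_le_spectrum hsa).1 h4 t ht
  · exact (le_algebraMap_iff_spectrum_le hsa).1 h3 t ht

end order

end TracialVN

namespace TracialVN

/-! ### Projective boundedness and contraction of oscillation. -/

section hennion

variable {H : Type*} [NormedAddCommGroup H] [InnerProductSpace ℂ H] [CompleteSpace H]
  {M : VonNeumannAlgebra H} (τ : TracialState M)

/-- `γ(x) / τ(γ(x)) ≤ c γ(y) / τ(γ(y))` for all positive `x`, `y`, in homogeneous form. -/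
def IsProjBounded (γ : L1 τ →L[ℂ] L1 τ) (c : ℝ) : Prop :=
  ∀ x ∈ posCone τ, ∀ y ∈ posCone τ,
    ((c : ℂ) * tr τ (γ x)) • γ y - tr τ (γ y) • γ x ∈ posCone τ

/-- For all positive `x`, `y` there is `l > 0` with `l γ(y) ≤ γ(x) ≤ (1 + R) l γ(y)`. -/
def IsOscBounded (γ : L1 τ →L[ℂ] L1 τ) (R : ℝ) : Prop :=
  ∀ x ∈ posCone τ, x ≠ 0 → ∀ y ∈ posCone τ, y ≠ 0 → ∃ l : ℝ, 0 < l ∧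
    γ x - (l : ℂ) • γ y ∈ posCone τ ∧ (((1 + R) * l : ℝ) : ℂ) • γ y - γ x ∈ posCone τ

/-- A positive faithful map. -/
def IsPosFaithful (γ : L1 τ →L[ℂ] L1 τ) : Prop :=
  IsPositiveL1 τ γ.toLinearMap ∧ IsFaithfulL1 τ γ.toLinearMap

variable {τ} {γ Γ : L1 τ →L[ℂ] L1 τ}

namespace IsPosFaithful

theorem mem (h : IsPosFaithful τ γ) {x : L1 τ} (hx : x ∈ posCone τ) : γ x ∈ posCone τ := h.1 x hx

theorem ne_zero (h : IsPosFaithful τ γ) {x : L1 τ} (hx : x ∈ posCone τ) (h0 : x ≠ 0) :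
    γ x ≠ 0 := fun h1 => h0 (h.2 x hx h1)

theorem id : IsPosFaithful τ (ContinuousLinearMap.id ℂ (L1 τ)) :=
  ⟨fun _ hx => hx, fun _ _ h => h⟩

theorem comp (h : IsPosFaithful τ γ) (h' : IsPosFaithful τ Γ) : IsPosFaithful τ (γ.comp Γ) :=
  ⟨fun _ hx => h.mem (h'.mem hx), fun x hx h0 => h'.2 x hx (h.2 _ (h'.mem hx) h0)⟩

theorem proj_mem_states (h : IsPosFaithful τ γ) {x : L1 τ} (hx : x ∈ states τ) :
    proj τ γ.toLinearMap x ∈ states τ :=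
  normalize_mem_states (h.mem hx.1) (h.ne_zero hx.1 (ne_zero_of_mem_states hx))

theorem proj_comp (γ : L1 τ →L[ℂ] L1 τ) (h' : IsPosFaithful τ Γ) {x : L1 τ} (hx : x ∈ states τ) :
    proj τ (γ.comp Γ).toLinearMap x = proj τ γ.toLinearMap (proj τ Γ.toLinearMap x) := by
  have h1 : tr τ (Γ x) ≠ 0 := by
    rw [tr_eq_norm (h'.mem hx.1)]
    simpa using h'.ne_zero hx.1 (ne_zero_of_mem_states hx)
  simp only [proj, ContinuousLinearMap.coe_coe, ContinuousLinearMap.coe_comp, Function.comp_apply,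
    map_smul, tr_smul, mul_inv, inv_inv, smul_smul]
  congr 1
  field_simp

end IsPosFaithful

theorem IsOscBounded.comp_left {R : ℝ} (h : IsOscBounded τ Γ R) (hγ : IsPosFaithful τ γ) :
    IsOscBounded τ (γ.comp Γ) R := fun x hx hx0 y hy hy0 => by
  obtain ⟨l, hl, h1, h2⟩ := h x hx hx0 y hy hy0
  refine ⟨l, hl, ?_, ?_⟩
  · simpa using hγ.mem h1
  · simpa using hγ.mem h2

/-- Using the bound for `(x, y)` and for `(y, x)` confines `γ x` between `c⁻¹` and `c` times `(‖γ x‖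
/ ‖γ y‖) • γ y`, a ratio of `c ^ 2`. -/
theorem IsProjBounded.isOscBounded {c : ℝ} (hc : 1 ≤ c) (hγ : IsPosFaithful τ γ)
    (h : IsProjBounded τ γ c) : IsOscBounded τ γ (c ^ 2 - 1) := fun x hx hx0 y hy hy0 => by
  have hx1 := h x hx y hy
  have hy1 := h y hy x hx
  have hnx : 0 < ‖γ x‖ := norm_pos_iff.2 (hγ.ne_zero hx hx0)
  have hny : 0 < ‖γ y‖ := norm_pos_iff.2 (hγ.ne_zero hy hy0)
  rw [tr_eq_norm (hγ.mem hx), tr_eq_norm (hγ.mem hy)] at hx1 hy1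
  refine ⟨‖γ x‖ / (c * ‖γ y‖), by positivity, ?_, ?_⟩
  · convert smul_mem_posCone (r := (c * ‖γ y‖)⁻¹) (by positivity) hy1 using 1
    have : (c : ℂ) ≠ 0 := by exact_mod_cast (by positivity : c ≠ 0)
    have : (‖γ y‖ : ℂ) ≠ 0 := by exact_mod_cast hny.ne'
    match_scalars <;> field_simp
  · convert smul_mem_posCone (r := (‖γ y‖)⁻¹) (by positivity) hx1 using 1
    have : (c : ℂ) ≠ 0 := by exact_mod_cast (by positivity : c ≠ 0)
    have : (‖γ y‖ : ℂ) ≠ 0 := by exact_mod_cast hny.ne'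
    match_scalars <;> field_simp
    ring

/-- A projectively bounded map contracts the oscillation by a fixed factor. -/
theorem IsOscBounded.contract {c R : ℝ} (hc : 1 ≤ c) (hγ : IsPosFaithful τ γ)
    (hΓ : IsPosFaithful τ Γ) (h : IsProjBounded τ γ c) (hR : 0 ≤ R) (hosc : IsOscBounded τ Γ R) :
    IsOscBounded τ (γ.comp Γ) ((1 - c⁻¹) * R) := fun x hx hx0 y hy hy0 => by
  obtain ⟨l, hl, h1, h2⟩ := hosc x hx hx0 y hy hy0
  set u := Γ x
  set v := Γ y
  have hu : u ∈ posCone τ := hΓ.mem hx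
  have hv : v ∈ posCone τ := hΓ.mem hy
  have hv0 : v ≠ 0 := hΓ.ne_zero hy hy0
  have hs : 0 < ‖γ v‖ := norm_pos_iff.2 (hγ.ne_zero hv hv0)
  have hsC : (‖γ v‖ : ℂ) ≠ 0 := by exact_mod_cast hs.ne'
  have hc0 : 0 < c := by positivity
  have hcC : (c : ℂ) ≠ 0 := by exact_mod_cast hc0.ne'
  have hp := h v hv _ h1
  have hq := h v hv _ h2
  set t := ‖γ u‖ / ‖γ v‖ with ht
  have htu : ‖γ u‖ = t * ‖γ v‖ := by rw [ht]; field_simp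
  have hlt : l ≤ t := by
    have h3 := tr_eq_norm (hγ.mem h1)
    rw [map_sub, map_smul, tr_sub, tr_smul, tr_eq_norm (hγ.mem hu), tr_eq_norm (hγ.mem hv)] at h3
    have h4 : ‖γ u‖ - l * ‖γ v‖ = ‖γ u - (l : ℂ) • γ v‖ := by exact_mod_cast h3
    have h5 : 0 ≤ ‖γ u‖ - l * ‖γ v‖ := h4 ▸ norm_nonneg _
    rw [ht, le_div_iff₀ hs]
    linarith
  rw [map_sub, map_smul, tr_sub, tr_smul, tr_eq_norm (hγ.mem hu), tr_eq_norm (hγ.mem hv), htu]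
    at hp hq
  have hκ : 0 < c⁻¹ := by positivity
  have hκ1 : c⁻¹ ≤ 1 := inv_le_one_of_one_le₀ hc
  have hp' := smul_mem_posCone (r := (c * ‖γ v‖)⁻¹) (by positivity) hp
  have hq' := smul_mem_posCone (r := (c * ‖γ v‖)⁻¹) (by positivity) hq
  -- Projective boundedness applied to `u - l v` and `(1 + R) l v - u` raises the lower coefficient
  -- by `c⁻¹ (t - l)` and lowers the upper one by `c⁻¹ ((1 + R) l - t)`. The gap becomes `(1 - c⁻¹)
  -- R l`, measured against a lower coefficient that is at least `l`.
  refine ⟨l + c⁻¹ * (t - l), by nlinarith, ?_, ?_⟩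
  · convert hp' using 1
    simp only [ContinuousLinearMap.comp_apply]
    match_scalars <;> field_simp
    ring
  · have h6 : 0 ≤ (1 - c⁻¹) * R * (c⁻¹ * (t - l)) := by
      have := sub_nonneg.2 hκ1
      have := sub_nonneg.2 hlt
      positivity
    convert add_mem_posCone hq' (smul_mem_posCone h6 (hγ.mem hv)) using 1
    simp only [ContinuousLinearMap.comp_apply]
    match_scalars <;> field_simp
    ring

/-- Normalized images under a map of oscillation `R` are comparable. -/
theorem IsOscBounded.proj_le {R : ℝ} (hγ : IsPosFaithful τ γ)
    (hR : 0 ≤ R) (h : IsOscBounded τ γ R) {x y : L1 τ} (hx : x ∈ states τ) (hy : y ∈ states τ) :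
    ((1 + R : ℝ) : ℂ) • proj τ γ.toLinearMap y - proj τ γ.toLinearMap x ∈ posCone τ := by
  obtain ⟨l, hl, h1, h2⟩ := h x hx.1 (ne_zero_of_mem_states hx) y hy.1 (ne_zero_of_mem_states hy)
  have hnx : 0 < ‖γ x‖ := norm_pos_iff.2 (hγ.ne_zero hx.1 (ne_zero_of_mem_states hx))
  have hny : 0 < ‖γ y‖ := norm_pos_iff.2 (hγ.ne_zero hy.1 (ne_zero_of_mem_states hy))
  have hnxC : (‖γ x‖ : ℂ) ≠ 0 := by exact_mod_cast hnx.ne'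
  have hnyC : (‖γ y‖ : ℂ) ≠ 0 := by exact_mod_cast hny.ne'
  have h3 := tr_eq_norm h1
  rw [tr_sub, tr_smul, tr_eq_norm (hγ.mem hx.1), tr_eq_norm (hγ.mem hy.1)] at h3
  have h4 : ‖γ x‖ - l * ‖γ y‖ = ‖γ x - (l : ℂ) • γ y‖ := by exact_mod_cast h3
  have h5 : 0 ≤ ‖γ x‖ - l * ‖γ y‖ := h4 ▸ norm_nonneg _
  -- Since `l ≤ ‖γ x‖ / ‖γ y‖`, the upper coefficient `(1 + R) l / ‖γ x‖` may be enlarged to `(1 +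
  -- R) / ‖γ y‖`.
  have h6 : 0 ≤ (1 + R) * (‖γ x‖ * ‖γ y‖)⁻¹ * (‖γ x‖ - l * ‖γ y‖) := by positivity
  simp only [proj, ContinuousLinearMap.coe_coe, tr_eq_norm (hγ.mem hx.1), tr_eq_norm (hγ.mem hy.1)]
  convert add_mem_posCone (smul_mem_posCone (r := ‖γ x‖⁻¹) (by positivity) h2)
    (smul_mem_posCone h6 (hγ.mem hy.1)) using 1
  match_scalars <;> field_simp
  ring

end hennion

end TracialVN

namespace TracialVN

/-! ### From strict Hennion contractions to projective boundedness. -/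

section contraction

open Set

variable {H : Type*} [NormedAddCommGroup H] [InnerProductSpace ℂ H] [CompleteSpace H]
  {M : VonNeumannAlgebra H} {τ : TracialState M} {γ : L1 τ →L[ℂ] L1 τ} {x y : L1 τ}

theorem le_one_of_sub_smul_mem (hx : x ∈ states τ) (hy : y ∈ states τ) {l : ℝ}
    (h : x - (l : ℂ) • y ∈ posCone τ) : l ≤ 1 := by
  have h1 := tr_eq_norm h
  rw [tr_sub, tr_smul, hx.2, hy.2] at h1
  have h2 : 1 - l = ‖x - (l : ℂ) • y‖ := by rw [mul_one] at h1; exact_mod_cast h1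
  linarith [norm_nonneg (x - (l : ℂ) • y)]

theorem bddAbove_mQuantity (hx : x ∈ states τ) (hy : y ∈ states τ) :
    BddAbove {l : ℝ | x - (l : ℂ) • y ∈ posCone τ} :=
  ⟨1, fun _ h => le_one_of_sub_smul_mem hx hy h⟩

theorem zero_mem_mQuantity (hx : x ∈ states τ) : (0 : ℝ) ∈ {l : ℝ | x - (l : ℂ) • y ∈ posCone τ} := by
  simpa using hx.1

theorem le_mQuantity (hx : x ∈ states τ) (hy : y ∈ states τ) {l : ℝ}
    (h : x - (l : ℂ) • y ∈ posCone τ) : l ≤ mQuantity τ x y :=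
  le_csSup (bddAbove_mQuantity hx hy) h

theorem mQuantity_nonneg (hx : x ∈ states τ) (hy : y ∈ states τ) : 0 ≤ mQuantity τ x y :=
  le_mQuantity hx hy (zero_mem_mQuantity hx)

theorem mQuantity_mem (hx : x ∈ states τ) (hy : y ∈ states τ) :
    x - (mQuantity τ x y : ℂ) • y ∈ posCone τ := by
  have hcl : IsClosed {l : ℝ | x - (l : ℂ) • y ∈ posCone τ} :=
    (isClosed_posCone τ).preimage
      (continuous_const.sub (Complex.continuous_ofReal.smul continuous_const))
  exact hcl.csSup_mem ⟨0, zero_mem_mQuantity hx⟩ (bddAbove_mQuantity hx hy)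

theorem mQuantity_le_one (hx : x ∈ states τ) (hy : y ∈ states τ) : mQuantity τ x y ≤ 1 :=
  le_one_of_sub_smul_mem hx hy (mQuantity_mem hx hy)

theorem mQuantity_mul_mem_Icc (hx : x ∈ states τ) (hy : y ∈ states τ) :
    mQuantity τ x y * mQuantity τ y x ∈ Icc (0 : ℝ) 1 :=
  ⟨mul_nonneg (mQuantity_nonneg hx hy) (mQuantity_nonneg hy hx),
    mul_le_one₀ (mQuantity_le_one hx hy) (mQuantity_nonneg hy hx) (mQuantity_le_one hy hx)⟩

/-- Apply `γ` to `m(x, y) y ≤ x` and normalize. -/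
theorem mQuantity_proj_ge (hγ : IsPosFaithful τ γ) (hx : x ∈ states τ) (hy : y ∈ states τ) :
    mQuantity τ x y * (‖γ y‖ / ‖γ x‖) ≤
      mQuantity τ (proj τ γ.toLinearMap x) (proj τ γ.toLinearMap y) := by
  refine le_mQuantity (hγ.proj_mem_states hx) (hγ.proj_mem_states hy) ?_
  have hnx : 0 < ‖γ x‖ := norm_pos_iff.2 (hγ.ne_zero hx.1 (ne_zero_of_mem_states hx))
  have hny : 0 < ‖γ y‖ := norm_pos_iff.2 (hγ.ne_zero hy.1 (ne_zero_of_mem_states hy))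
  have hnxC : (‖γ x‖ : ℂ) ≠ 0 := by exact_mod_cast hnx.ne'
  have hnyC : (‖γ y‖ : ℂ) ≠ 0 := by exact_mod_cast hny.ne'
  have h1 := hγ.mem (mQuantity_mem hx hy)
  rw [map_sub, map_smul] at h1
  simp only [proj, ContinuousLinearMap.coe_coe, tr_eq_norm (hγ.mem hx.1), tr_eq_norm (hγ.mem hy.1)]
  convert smul_mem_posCone (r := ‖γ x‖⁻¹) (by positivity) h1 using 1
  match_scalars <;> field_simp

/-- The normalizing factors of the two one-sided estimates are inverse to each other; this is why
the metric uses the product. -/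
theorem mQuantity_mul_le_proj (hγ : IsPosFaithful τ γ) (hx : x ∈ states τ) (hy : y ∈ states τ) :
    mQuantity τ x y * mQuantity τ y x ≤
      mQuantity τ (proj τ γ.toLinearMap x) (proj τ γ.toLinearMap y) *
      mQuantity τ (proj τ γ.toLinearMap y) (proj τ γ.toLinearMap x) := by
  have hnx : 0 < ‖γ x‖ := norm_pos_iff.2 (hγ.ne_zero hx.1 (ne_zero_of_mem_states hx))
  have hny : 0 < ‖γ y‖ := norm_pos_iff.2 (hγ.ne_zero hy.1 (ne_zero_of_mem_states hy))
  have h1 := mul_le_mul (mQuantity_proj_ge hγ hx hy) (mQuantity_proj_ge hγ hy hx)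
    (mul_nonneg (mQuantity_nonneg hy hx) (by positivity))
    (mQuantity_nonneg (hγ.proj_mem_states hx) (hγ.proj_mem_states hy))
  refine le_trans (le_of_eq ?_) h1
  field_simp

theorem hennionDist_nonneg (hx : x ∈ states τ) (hy : y ∈ states τ) : 0 ≤ hennionDist τ x y := by
  have h := mQuantity_mul_mem_Icc hx hy
  exact div_nonneg (by linarith [h.2]) (by linarith [h.1])

theorem hennionDist_le_one (hx : x ∈ states τ) (hy : y ∈ states τ) : hennionDist τ x y ≤ 1 := by
  have h := mQuantity_mul_mem_Icc hx hy
  exact (div_le_one (by linarith [h.1])).2 (by linarith [h.1])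

/-- Positive faithful maps do not increase the Hennion metric. -/
theorem hennionDist_proj_le (hγ : IsPosFaithful τ γ) (hx : x ∈ states τ) (hy : y ∈ states τ) :
    hennionDist τ (proj τ γ.toLinearMap x) (proj τ γ.toLinearMap y) ≤ hennionDist τ x y := by
  have h := mQuantity_mul_mem_Icc hx hy
  have h1 := mQuantity_mul_le_proj hγ hx hy
  exact div_le_div₀ (by linarith [h.2]) (by linarith) (by linarith [h.1]) (by linarith)

/-- Since `d ≤ 1`, a contraction ratio is also an absolute bound on the diameter of the image.
Non-expansiveness bounds the set of ratios, so its real supremum is meaningful, and it covers the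
case of a zero denominator. -/
theorem IsPosFaithful.hennionDist_proj_le_max (hγ : IsPosFaithful τ γ) (hx : x ∈ states τ)
    (hy : y ∈ states τ) (hxy : x ≠ y) :
    hennionDist τ (proj τ γ.toLinearMap x) (proj τ γ.toLinearMap y) ≤
      max (contractionConst τ γ.toLinearMap) 0 := by
  have hle := hennionDist_proj_le hγ hx hy
  rcases (hennionDist_nonneg hx hy).eq_or_lt with h0 | h0
  · exact (hle.trans h0.ge).trans (le_max_right _ _)
  have h1 : hennionDist τ (proj τ γ.toLinearMap x) (proj τ γ.toLinearMap y) / hennionDist τ x y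
      ≤ contractionConst τ γ.toLinearMap := by
    refine le_csSup ⟨1, ?_⟩ ⟨x, hx, y, hy, hxy, rfl⟩
    rintro _ ⟨u, hu, v, hv, -, rfl⟩
    exact div_le_one_of_le₀ (hennionDist_proj_le hγ hu hv) (hennionDist_nonneg hu hv)
  rw [div_le_iff₀ h0] at h1
  refine h1.trans ((mul_le_mul_of_nonneg_right (le_max_left _ 0) h0.le).trans ?_)
  exact mul_le_of_le_one_right (le_max_right _ _) (hennionDist_le_one hx hy)

theorem proj_smul (γ : L1 τ →L[ℂ] L1 τ) {s : ℂ} (hs : s ≠ 0) (x : L1 τ) :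
    proj τ γ.toLinearMap (s • x) = proj τ γ.toLinearMap x := by
  simp only [proj, map_smul, tr_smul, smul_smul]
  congr 1
  field_simp

theorem IsProjBounded.mono (hγ : IsPosFaithful τ γ) {c c' : ℝ} (h : IsProjBounded τ γ c)
    (hcc' : c ≤ c') : IsProjBounded τ γ c' := fun x hx y hy => by
  have h1 := smul_mem_posCone (mul_nonneg (sub_nonneg.2 hcc') (norm_nonneg (γ x))) (hγ.mem hy)
  convert add_mem_posCone (h x hx y hy) h1 using 1
  rw [tr_eq_norm (hγ.mem hx)]
  match_scalars <;> ring

/-- A strict Hennion contraction has projectively bounded range. -/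
theorem exists_isProjBounded_of_isSHC (h : IsSHC τ γ.toLinearMap) :
    ∃ c : ℝ, 1 ≤ c ∧ IsProjBounded τ γ c := by
  have hγ : IsPosFaithful τ γ := ⟨h.1, h.2.1⟩
  set q := max (contractionConst τ γ.toLinearMap) 0 with hq
  have hq0 : 0 ≤ q := le_max_right _ _
  have hq1 : q < 1 := max_lt h.2.2 one_pos
  -- `(1 - p) / (1 + p) ≤ q` means `κ ≤ p`. Here `p` is a product of two quantities at most `1`, so
  -- each of them is at least `κ`.
  set κ := (1 - q) / (1 + q) with hκ
  have hκ0 : 0 < κ := div_pos (by linarith) (by linarith)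
  have hκ1 : κ ≤ 1 := (div_le_one (by linarith)).2 (by linarith)
  have key : ∀ x ∈ states τ, ∀ y ∈ states τ,
      proj τ γ.toLinearMap x - (κ : ℂ) • proj τ γ.toLinearMap y ∈ posCone τ := by
    intro x hx y hy
    have hx' := hγ.proj_mem_states hx
    have hy' := hγ.proj_mem_states hy
    rcases eq_or_ne x y with rfl | hxy
    · convert smul_mem_posCone (sub_nonneg.2 hκ1) hx'.1 using 1
      match_scalars
      ring
    have h1 := hγ.hennionDist_proj_le_max hx hy hxy
    have h2 := mQuantity_mul_mem_Icc hx' hy'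
    have h3 : κ ≤ mQuantity τ (proj τ γ.toLinearMap x) (proj τ γ.toLinearMap y) := by
      rw [hennionDist, div_le_iff₀ (by linarith [h2.1]), ← hq] at h1
      refine le_trans ?_ (mul_le_of_le_one_right (mQuantity_nonneg hx' hy')
        (mQuantity_le_one hy' hx'))
      rw [hκ, div_le_iff₀ (by linarith)]
      linarith
    convert add_mem_posCone (mQuantity_mem hx' hy')
      (smul_mem_posCone (sub_nonneg.2 h3) hy'.1) using 1
    match_scalars <;> ring
  refine ⟨κ⁻¹, (one_le_inv₀ hκ0).2 hκ1, fun x hx y hy => ?_⟩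
  rcases eq_or_ne x 0 with rfl | hx0
  · simpa [tr] using zero_mem_posCone
  rcases eq_or_ne y 0 with rfl | hy0
  · simpa [tr] using zero_mem_posCone
  have hnx : 0 < ‖γ x‖ := norm_pos_iff.2 (hγ.ne_zero hx hx0)
  have hny : 0 < ‖γ y‖ := norm_pos_iff.2 (hγ.ne_zero hy hy0)
  have h1 := key _ (normalize_mem_states hy hy0) _ (normalize_mem_states hx hx0)
  have htr : ∀ z ∈ posCone τ, z ≠ 0 → (tr τ z)⁻¹ ≠ 0 := fun z hz hz0 => by
    rw [tr_eq_norm hz]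
    simpa using hz0
  rw [proj_smul _ (htr y hy hy0), proj_smul _ (htr x hx hx0)] at h1
  simp only [proj, ContinuousLinearMap.coe_coe, tr_eq_norm (hγ.mem hx), tr_eq_norm (hγ.mem hy)]
    at h1 ⊢
  convert smul_mem_posCone (r := κ⁻¹ * ‖γ x‖ * ‖γ y‖) (by positivity) h1 using 1
  have hnxC : (‖γ x‖ : ℂ) ≠ 0 := by exact_mod_cast hnx.ne'
  have hnyC : (‖γ y‖ : ℂ) ≠ 0 := by exact_mod_cast hny.ne'
  have hκC : (κ : ℂ) ≠ 0 := by exact_mod_cast hκ0.ne'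
  match_scalars <;> field_simp

end contraction

end TracialVN

namespace TracialVN

/-! ### Deterministic products along a two-sided sequence and their backward limits. -/

section sequences

open Filter Topology

variable {H : Type*} [NormedAddCommGroup H] [InnerProductSpace ℂ H] [CompleteSpace H]
  {M : VonNeumannAlgebra H} {τ : TracialState M}

/-- The product `g (m + k - 1) ∘ ⋯ ∘ g m` of `k` consecutive maps. -/
noncomputable def seqComp (g : ℤ → L1 τ →L[ℂ] L1 τ) (m : ℤ) : ℕ → L1 τ →L[ℂ] L1 τ
  | 0 => ContinuousLinearMap.id ℂ (L1 τ)
  | k + 1 => (g (m + k)).comp (seqComp g m k)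

variable (g : ℤ → L1 τ →L[ℂ] L1 τ)

theorem seqComp_add (m : ℤ) (k l : ℕ) :
    seqComp g m (k + l) = (seqComp g (m + k) l).comp (seqComp g m k) := by
  induction l with
  | zero => rfl
  | succ l ih =>
    rw [← add_assoc, seqComp, ih, seqComp, ContinuousLinearMap.comp_assoc]
    push_cast
    rw [add_assoc]

theorem seqComp_shift (j m : ℤ) (k : ℕ) :
    seqComp (fun i => g (i + j)) m k = seqComp g (m + j) k := by
  induction k with
  | zero => rfl
  | succ k ih =>
    rw [seqComp, seqComp, ih, add_right_comm]

variable {g}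

theorem isPosFaithful_seqComp (hg : ∀ i, IsPosFaithful τ (g i)) (m : ℤ) (k : ℕ) :
    IsPosFaithful τ (seqComp g m k) := by
  induction k with
  | zero => exact .id
  | succ k ih => exact (hg _).comp ih

theorem seqComp_ofM (hg : ∀ i a, ∃ b : M, g i (ofM τ a) = ofM τ b) (m : ℤ) (k : ℕ) (a : M) :
    ∃ b : M, seqComp g m k (ofM τ a) = ofM τ b := by
  induction k with
  | zero => exact ⟨a, rfl⟩
  | succ k ih =>
    obtain ⟨b, hb⟩ := ih
    obtain ⟨c, hc⟩ := hg (m + k) b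
    exact ⟨c, by rw [seqComp, ContinuousLinearMap.comp_apply, hb, hc]⟩

/-- The product of all `g i` with `m ≤ i ≤ n`. -/
noncomputable def intervalComp (g : ℤ → L1 τ →L[ℂ] L1 τ) (n m : ℤ) : L1 τ →L[ℂ] L1 τ :=
  seqComp g m (n + 1 - m).toNat

/-- The extreme cases `l = m` and `l = n + 1` are allowed: an empty interval gives the identity. -/
theorem intervalComp_trans {n l m : ℤ} (h1 : m ≤ l) (h2 : l ≤ n + 1) :
    intervalComp g n m = (intervalComp g n l).comp (intervalComp g (l - 1) m) := by
  obtain ⟨a, rfl⟩ := Int.le.dest h1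
  obtain ⟨b, hb⟩ := Int.le.dest h2
  have e1 : (n + 1 - m).toNat = a + b := by omega
  have e2 : (n + 1 - (m + a)).toNat = b := by omega
  have e3 : (m + a - 1 + 1 - m).toNat = a := by omega
  rw [intervalComp, intervalComp, intervalComp, e1, e2, e3, seqComp_add]

theorem intervalComp_succ {n m : ℤ} (h : m ≤ n + 1) :
    intervalComp g (n + 1) m = (g (n + 1)).comp (intervalComp g n m) := by
  obtain ⟨a, ha⟩ := Int.le.dest h
  have e1 : (n + 1 + 1 - m).toNat = a + 1 := by omega
  have e2 : (n + 1 - m).toNat = a := by omega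
  rw [intervalComp, intervalComp, e1, e2, seqComp, ha]

theorem intervalComp_shift (j n m : ℤ) :
    intervalComp (fun i => g (i + j)) n m = intervalComp g (n + j) (m + j) := by
  rw [intervalComp, intervalComp, seqComp_shift]
  congr 2
  ring

theorem isPosFaithful_intervalComp (hg : ∀ i, IsPosFaithful τ (g i)) (n m : ℤ) :
    IsPosFaithful τ (intervalComp g n m) := isPosFaithful_seqComp hg _ _

/-- Recurring projectively bounded blocks make the oscillation decay geometrically. -/
theorem exists_isOscBounded (hg : ∀ i, IsPosFaithful τ (g i)) {c : ℝ} (hc : 1 ≤ c) {k : ℕ}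
    (hgood : ∀ n : ℤ, ∃ j ≤ n, IsProjBounded τ (seqComp g j k) c) (N : ℕ) (n : ℤ) :
    ∃ m ≤ n, IsOscBounded τ (intervalComp g n m) ((1 - c⁻¹) ^ N * (c ^ 2 - 1)) := by
  have hF := isPosFaithful_intervalComp hg
  have hblock : ∀ j : ℤ, seqComp g j k = intervalComp g (j + k - 1) j := fun j => by
    rw [intervalComp]
    congr 1
    omega
  have hκ : 0 ≤ 1 - c⁻¹ := sub_nonneg.2 (inv_le_one_of_one_le₀ hc)
  have hc2 : 0 ≤ c ^ 2 - 1 := by nlinarith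
  induction N generalizing n with
  | zero =>
    obtain ⟨j, hj, h⟩ := hgood (n - k)
    rw [hblock] at h
    refine ⟨j, by omega, ?_⟩
    rw [pow_zero, one_mul, intervalComp_trans (l := j + k) (by omega) (by omega)]
    exact (h.isOscBounded hc (hF _ _)).comp_left (hF _ _)
  | succ N ih =>
    -- `j ≤ n - k` keeps the good block below `n`. The induction hypothesis handles the indices
    -- before `j`, the block contracts, and the remaining maps on the left are harmless.
    obtain ⟨j, hj, h⟩ := hgood (n - k)
    rw [hblock] at h
    obtain ⟨m, hm, h1⟩ := ih (j - 1)
    refine ⟨m, by omega, ?_⟩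
    have h2 := h1.contract hc (hF _ _) (hF _ _) h (by positivity)
    rw [pow_succ', mul_assoc, intervalComp_trans (l := j + k) (by omega) (by omega),
      intervalComp_trans (n := j + k - 1) (m := m) (l := j) (by omega) (by omega)]
    exact h2.comp_left (hF _ _)

/-- Forgetting of the initial state: all normalized images of states under `g n ∘ ⋯ ∘ g m`
become comparable with ratio close to `1` as `m → -∞`. -/
theorem exists_forall_proj_le (hg : ∀ i, IsPosFaithful τ (g i)) {c : ℝ} (hc : 1 ≤ c) {k : ℕ}
    (hgood : ∀ n : ℤ, ∃ j ≤ n, IsProjBounded τ (seqComp g j k) c) (n : ℤ) {ε : ℝ} (hε : 0 < ε) :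
    ∃ m₀ ≤ n, ∀ m ≤ m₀, ∀ m' ≤ m₀, ∀ x ∈ states τ, ∀ y ∈ states τ,
      ((1 + ε : ℝ) : ℂ) • proj τ (intervalComp g n m').toLinearMap y
        - proj τ (intervalComp g n m).toLinearMap x ∈ posCone τ := by
  have hF := isPosFaithful_intervalComp hg
  have hκ : 0 ≤ 1 - c⁻¹ := sub_nonneg.2 (inv_le_one_of_one_le₀ hc)
  have hκ1 : 1 - c⁻¹ < 1 := by
    have : 0 < c⁻¹ := by positivity
    linarith
  have hlim : Tendsto (fun N : ℕ => (1 - c⁻¹) ^ N * (c ^ 2 - 1)) atTop (𝓝 (0 * (c ^ 2 - 1))) :=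
    (tendsto_pow_atTop_nhds_zero_of_lt_one hκ hκ1).mul_const _
  rw [zero_mul] at hlim
  obtain ⟨N, hN⟩ := (hlim.eventually (gt_mem_nhds hε)).exists
  obtain ⟨m₀, hm₀, h⟩ := exists_isOscBounded hg hc hgood N n
  have hR : 0 ≤ (1 - c⁻¹) ^ N * (c ^ 2 - 1) := mul_nonneg (pow_nonneg hκ _) (by nlinarith)
  refine ⟨m₀, hm₀, fun m hm m' hm' x hx y hy => ?_⟩
  -- Both products share the factor from `m₀` to `n`; the earlier factors only replace `x` and `y`
  -- by other states, whence uniformity in `m` and `m'`.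
  rw [intervalComp_trans (n := n) hm (by omega), intervalComp_trans (n := n) hm' (by omega),
    IsPosFaithful.proj_comp _ (hF _ _) hx, IsPosFaithful.proj_comp _ (hF _ _) hy]
  have hx' := (hF (m₀ - 1) m).proj_mem_states hx
  have hy' := (hF (m₀ - 1) m').proj_mem_states hy
  convert add_mem_posCone (h.proj_le (hF _ _) hR hx' hy')
    (smul_mem_posCone (sub_nonneg.2 hN.le) ((hF n m₀).proj_mem_states hy').1) using 1
  match_scalars <;> ring

theorem opNorm_ofM_le (a : M) : opNorm τ (ofM τ a) ≤ ‖a‖ₑ :=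
  iInf_le (fun b : {b : M // ofM τ b = ofM τ a} => ‖(b : M)‖ₑ) ⟨a, rfl⟩

theorem ofM_le_smul_iff {a b : M} {r : ℝ} :
    (r : ℂ) • ofM τ b - ofM τ a ∈ posCone τ ↔ a ≤ r • b := by
  rw [← map_smul, ← map_sub, ofM_mem_posCone_iff, sub_nonneg, Complex.coe_smul]

/-- A one-sided bound suffices for states: `(1 + ε) y - x` is positive of trace `ε`, hence of norm
`ε`. -/
theorem norm_sub_le_of_comparable {x y : L1 τ} (hx : x ∈ states τ) (hy : y ∈ states τ) {ε : ℝ}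
    (hε : 0 ≤ ε) (h : ((1 + ε : ℝ) : ℂ) • y - x ∈ posCone τ) : ‖x - y‖ ≤ 2 * ε := by
  have h1 := tr_eq_norm h
  rw [tr_sub, tr_smul, hx.2, hy.2, mul_one] at h1
  have h2 : 1 + ε - 1 = ‖((1 + ε : ℝ) : ℂ) • y - x‖ := by exact_mod_cast h1
  have h3 : x - y = (ε : ℂ) • y - (((1 + ε : ℝ) : ℂ) • y - x) := by
    match_scalars <;> ring
  rw [h3]
  refine (norm_sub_le _ _).trans ?_
  rw [← h2, norm_smul, norm_eq_one_of_mem_states hy, Complex.norm_of_nonneg hε]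
  linarith

/-- Convergence of `g n ∘ ⋯ ∘ g m · x` as `m → -∞` to a bounded state independent of `x`. -/
theorem exists_tendsto_intervalComp (hg : ∀ i, IsPosFaithful τ (g i))
    (hgM : ∀ i a, ∃ b : M, g i (ofM τ a) = ofM τ b) {c : ℝ} (hc : 1 ≤ c) {k : ℕ}
    (hgood : ∀ n : ℤ, ∃ j ≤ n, IsProjBounded τ (seqComp g j k) c) (n : ℤ) :
    ∃ z ∈ boundedStates τ,
      (∀ x ∈ states τ,
        Tendsto (fun m : ℤ => proj τ (intervalComp g n m).toLinearMap x) atBot (𝓝 z)) ∧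
      ∀ x ∈ boundedStates τ,
        Tendsto (fun m : ℤ => opNorm τ (proj τ (intervalComp g n m).toLinearMap x - z))
          atBot (𝓝 0) := by
  have hF := isPosFaithful_intervalComp hg
  have key := fun {ε : ℝ} (hε : 0 < ε) => exists_forall_proj_le hg hc hgood n hε
  have hM : ∀ (m : ℤ) (a : M), ∃ b : M, proj τ (intervalComp g n m).toLinearMap (ofM τ a) = ofM τ b :=
    fun m a => by
      obtain ⟨b, hb⟩ := seqComp_ofM hgM m (n + 1 - m).toNat a
      exact ⟨(tr τ (ofM τ b))⁻¹ • b, by rw [proj, ContinuousLinearMap.coe_coe, intervalComp, hb,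
        map_smul]⟩
  choose f hf using hM
  have h1S : ofM τ 1 ∈ states τ := ofM_one_mem_boundedStates.1
  have hfpos : ∀ m a, ofM τ a ∈ states τ → 0 ≤ f m a := fun m a ha => by
    rw [← ofM_mem_posCone_iff (τ := τ), ← hf]
    exact ((hF n m).proj_mem_states ha).1
  obtain ⟨m₁, -, hm₁⟩ := key one_pos
  -- Comparability with `ε = 1` gives `f m a ≤ 2 • f m₁ 1`, an operator-norm bound uniform in `m ≤
  -- m₁` and in the bounded state `a`.
  set K := 2 * ‖f m₁ 1‖ with hKdef
  have hK0 : 0 ≤ K := by positivity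
  have hK : ∀ m ≤ m₁, ∀ a, ofM τ a ∈ states τ → ‖f m a‖ ≤ K := fun m hm a ha => by
    have h := hm₁ m hm m₁ le_rfl _ ha _ h1S
    rw [hf, hf, ofM_le_smul_iff] at h
    refine (CStarAlgebra.norm_le_norm_of_nonneg_of_le (hfpos m a ha) h).trans ?_
    rw [norm_smul, hKdef]
    norm_num
  have hclose : ∀ ε > 0, ∃ m₀, ∀ m ≤ m₀, ∀ m' ≤ m₀, ∀ a b, ofM τ a ∈ states τ →
      ofM τ b ∈ states τ → ‖f m a - f m' b‖ ≤ ε := fun ε hε => by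
    obtain ⟨m₀, -, hm₀⟩ := key (ε := ε / (K + 1)) (by positivity)
    refine ⟨min m₀ m₁, fun m hm m' hm' a b ha hb => ?_⟩
    rw [le_min_iff] at hm hm'
    have h1 := hm₀ m hm.1 m' hm'.1 _ ha _ hb
    have h2 := hm₀ m' hm'.1 m hm.1 _ hb _ ha
    rw [hf, hf, ofM_le_smul_iff] at h1 h2
    refine (norm_sub_le_of_order (hfpos _ _ ha) (hfpos _ _ hb) (by positivity) (hK m hm.2 a ha)
      (hK m' hm'.2 b hb) h1 h2).trans ?_
    rw [div_mul_eq_mul_div, div_le_iff₀ (by positivity)]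
    nlinarith
  have hcauchy : Cauchy (map (fun m => f m 1) atBot) := by
    refine Metric.cauchy_iff.2 ⟨inferInstance, fun ε hε => ?_⟩
    obtain ⟨m₀, hm₀⟩ := hclose (ε / 2) (by positivity)
    refine ⟨(fun m => f m 1) '' Set.Iic m₀, image_mem_map (Iic_mem_atBot m₀), ?_⟩
    rintro _ ⟨m, hm, rfl⟩ _ ⟨m', hm', rfl⟩
    rw [dist_eq_norm]
    exact (hm₀ m hm m' hm' 1 1 h1S h1S).trans_lt (by linarith)
  obtain ⟨b, hb⟩ := CompleteSpace.complete hcauchy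
  have hb' : Tendsto (fun m => f m 1) atBot (𝓝 b) := hb
  have hofM : Continuous (ofM τ) :=
    AddMonoidHomClass.continuous_of_bound (ofM τ) 1 fun a => by
      simpa using norm_ofM_le τ a
  have hlim1 : Tendsto (fun m : ℤ => proj τ (intervalComp g n m).toLinearMap (ofM τ 1)) atBot
      (𝓝 (ofM τ b)) := by
    simp only [hf]
    exact (hofM.tendsto b).comp hb'
  have hbS : ofM τ b ∈ states τ := by
    refine IsClosed.mem_of_tendsto ?_ hlim1
      (Eventually.of_forall fun m => (hF n m).proj_mem_states h1S)
    exact (isClosed_posCone τ).inter (isClosed_eq (continuous_tr τ) continuous_const)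
  refine ⟨ofM τ b, ⟨hbS, b, rfl⟩, fun x hx => ?_, ?_⟩
  -- A general state need not lie in `M`, so it is compared with the orbit of `1` in `‖·‖₁` only.
  · refine tendsto_of_tendsto_of_dist hlim1 ?_
    rw [Metric.tendsto_nhds]
    intro ε hε
    obtain ⟨m₀, -, hm₀⟩ := key (ε := ε / 4) (by positivity)
    filter_upwards [Iic_mem_atBot m₀] with m hm
    have h := norm_sub_le_of_comparable ((hF n m).proj_mem_states h1S)
      ((hF n m).proj_mem_states hx) (by positivity) (hm₀ m hm m hm _ h1S _ hx)
    rw [Real.dist_eq, sub_zero, abs_of_nonneg dist_nonneg, dist_eq_norm]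
    linarith
  · rintro _ ⟨hxS, a, rfl⟩
    have hlim : Tendsto (fun m => f m a) atBot (𝓝 b) := by
      refine tendsto_of_tendsto_of_dist hb' ?_
      rw [Metric.tendsto_nhds]
      intro ε hε
      obtain ⟨m₀, hm₀⟩ := hclose (ε / 2) (by positivity)
      filter_upwards [Iic_mem_atBot m₀] with m hm
      have h := hm₀ m hm m hm _ _ h1S hxS
      rw [Real.dist_eq, sub_zero, abs_of_nonneg dist_nonneg, dist_eq_norm]
      linarith
    have h0 : Tendsto (fun m => ‖f m a - b‖ₑ) atBot (𝓝 0) := by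
      have := (hlim.sub_const b).enorm
      simpa using this
    refine tendsto_of_tendsto_of_tendsto_of_le_of_le tendsto_const_nhds h0 (fun _ => bot_le)
      fun m => ?_
    change opNorm τ (proj τ (intervalComp g n m).toLinearMap (ofM τ a) - ofM τ b) ≤ _
    rw [hf, ← map_sub]
    exact opNorm_ofM_le _

theorem continuousAt_proj {γ : L1 τ →L[ℂ] L1 τ} (hγ : IsPosFaithful τ γ) {x : L1 τ}
    (hx : x ∈ states τ) : ContinuousAt (proj τ γ.toLinearMap) x := by
  have h0 : tr τ (γ x) ≠ 0 := by
    rw [tr_eq_norm (hγ.mem hx.1)]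
    simpa using hγ.ne_zero hx.1 (ne_zero_of_mem_states hx)
  exact (((continuous_tr τ).comp γ.continuous).continuousAt.inv₀ h0).smul
    γ.continuous.continuousAt

/-- The limit states form an orbit. -/
theorem proj_eq_of_tendsto (hg : ∀ i, IsPosFaithful τ (g i)) {n : ℤ} {x z z' : L1 τ}
    (hx : x ∈ states τ) (hzS : z ∈ states τ)
    (hz : Tendsto (fun m : ℤ => proj τ (intervalComp g n m).toLinearMap x) atBot (𝓝 z))
    (hz' : Tendsto (fun m : ℤ => proj τ (intervalComp g (n + 1) m).toLinearMap x) atBot (𝓝 z')) :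
    proj τ (g (n + 1)).toLinearMap z = z' := by
  refine tendsto_nhds_unique ((continuousAt_proj (hg _) hzS).tendsto.comp hz) (hz'.congr' ?_)
  filter_upwards [Iic_mem_atBot (n + 1)] with m hm
  rw [intervalComp_succ hm, IsPosFaithful.proj_comp _ (isPosFaithful_intervalComp hg _ _) hx]
  rfl

end sequences

end TracialVN

namespace TracialVN

/-! ### Measurability of the extended maps and of projective boundedness. -/

section measurability

open Filter Topology MeasureTheory Set

variable {H : Type*} [NormedAddCommGroup H] [InnerProductSpace ℂ H] [CompleteSpace H]
  {M : VonNeumannAlgebra H} {τ : TracialState M}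

/-- `M` is norming for `L¹(M, τ)`. -/
theorem exists_pairing_ge (x : L1 τ) {ε : ℝ} (hε : 0 < ε) :
    ∃ b : M, ‖b‖ ≤ 1 ∧ ‖x‖ - ε ≤ ‖pairing τ x b‖ := by
  obtain ⟨a, ha⟩ := (Metric.denseRange_iff.1 (denseRange_ofM τ)) x (ε / 3) (by positivity)
  rw [dist_eq_norm] at ha
  obtain ⟨u, hu, -, hle⟩ := exists_approx_polar a (show 0 < ε / 3 by positivity)
  have hu' : ‖star u‖ ≤ 1 := by rwa [norm_star]
  refine ⟨star u, hu', ?_⟩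
  have h1 := tracialState_re_le τ hle
  have h2 : (τ (CFC.abs a - algebraMap ℝ M (ε / 3))).re = ‖ofM τ a‖ - ε / 3 := by
    rw [map_sub, Complex.sub_re, norm_ofM]
    congr 1
    refine (re_apply_algebraMap τ.toPositive (ε / 3)).trans ?_
    change ε / 3 * (τ 1).re = _
    rw [τ.map_one']
    simp
  rw [h2, τ.map_mul_comm', ← pairing_ofM] at h1
  have h3 := h1.trans (Complex.re_le_norm _)
  have h4 : ‖pairing τ (x - ofM τ a) (star u)‖ ≤ ε / 3 :=
    (norm_pairing_le τ _ _).trans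
      ((mul_le_of_le_one_right (norm_nonneg _) hu').trans ha.le)
  have h5 : ‖pairing τ (ofM τ a) (star u)‖ ≤
      ‖pairing τ x (star u)‖ + ‖pairing τ (x - ofM τ a) (star u)‖ := by
    have := norm_sub_le (pairing τ x (star u)) (pairing τ (x - ofM τ a) (star u))
    simpa using this
  have h6 : ‖x‖ ≤ ‖x - ofM τ a‖ + ‖ofM τ a‖ := by
    simpa using norm_add_le (x - ofM τ a) (ofM τ a)
  linarith

/-- Take almost norming elements of `M` for a dense sequence. A nonzero `x` killed by all of them
would be too far from its approximants. -/
theorem exists_separating_seq [TopologicalSpace.SeparableSpace (L1 τ)] :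
    ∃ b : ℕ → M, ∀ x : L1 τ, (∀ k, pairing τ x (b k) = 0) → x = 0 := by
  set e := TopologicalSpace.denseSeq (L1 τ)
  have h : ∀ k, ∃ b : M, ‖b‖ ≤ 1 ∧ (e k ≠ 0 → ‖e k‖ / 2 ≤ ‖pairing τ (e k) b‖) := fun k => by
    rcases eq_or_ne (e k) 0 with h0 | h0
    · exact ⟨0, by simp, fun h => absurd h0 h⟩
    · obtain ⟨b, hb, hb'⟩ := exists_pairing_ge (e k) (half_pos (norm_pos_iff.2 h0))
      exact ⟨b, hb, fun _ => by linarith⟩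
  choose b hb hb' using h
  refine ⟨b, fun x hx => ?_⟩
  by_contra h0
  have hx0 := norm_pos_iff.2 h0
  obtain ⟨k, hk⟩ := Metric.denseRange_iff.1 (TopologicalSpace.denseRange_denseSeq (L1 τ)) x
    (‖x‖ / 4) (by positivity)
  rw [dist_eq_norm] at hk
  change ‖x - e k‖ < _ at hk
  have h6 : ‖x‖ ≤ ‖x - e k‖ + ‖e k‖ := by simpa using norm_add_le (x - e k) (e k)
  have h7 : e k ≠ 0 := by
    rw [← norm_pos_iff]
    linarith
  have h1 := hb' k h7
  have h2 : pairing τ (x - e k) (b k) = - pairing τ (e k) (b k) := by simp [hx k]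
  have h3 := norm_pairing_le τ (x - e k) (b k)
  rw [h2, norm_neg] at h3
  have h4 := h3.trans (mul_le_of_le_one_right (norm_nonneg _) (hb k))
  linarith

variable {Ω : Type*} [MeasurableSpace Ω]

/-- Pettis' theorem: weak measurability against `M` implies strong measurability. -/
theorem stronglyMeasurable_of_pairing [TopologicalSpace.SeparableSpace (L1 τ)] {f : Ω → L1 τ}
    (hf : ∀ b : M, Measurable fun ω => pairing τ (f ω) b) : StronglyMeasurable f := by
  borelize (L1 τ)
  have : SecondCountableTopology (L1 τ) := UniformSpace.secondCountable_of_separable _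
  obtain ⟨b, hb⟩ := exists_separating_seq (τ := τ)
  let F : L1 τ → ℕ → ℂ := fun x k => pairing τ x (b k)
  have hF : Continuous F := continuous_pi fun k => by fun_prop
  have hinj : Function.Injective F := fun x y hxy => by
    refine sub_eq_zero.1 (hb _ fun k => ?_)
    have := congrFun hxy k
    change pairing τ x (b k) = pairing τ y (b k) at this
    simp [this]
  refine Measurable.stronglyMeasurable ?_
  -- Lusin–Souslin: a continuous injection from the Polish space `L1 τ` is a measurable embedding.
  rw [← (hF.measurableEmbedding hinj).measurable_comp_iff]
  exact measurable_pi_lambda _ fun k => hf _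

variable {P : Measure Ω} {E F : Type*} [NormedAddCommGroup E] [NormedSpace ℂ E]
  [NormedAddCommGroup F] [NormedSpace ℂ F]

/-- Evaluation of a pointwise measurable random operator at a random vector. -/
theorem aestronglyMeasurable_clm_apply {G : Ω → E →L[ℂ] F} {f : Ω → E}
    (hG : ∀ x, AEStronglyMeasurable (fun ω => G ω x) P) (hf : AEStronglyMeasurable f P) :
    AEStronglyMeasurable (fun ω => G ω (f ω)) P := by
  obtain ⟨f', hf', hff'⟩ := hf
  suffices h : AEStronglyMeasurable (fun ω => G ω (f' ω)) P from
    h.congr (hff'.symm.mono fun ω h => by simp only [h])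
  refine aestronglyMeasurable_of_tendsto_ae (u := atTop)
    (f := fun n ω => G ω (hf'.approx n ω)) (fun n => ?_)
    (ae_of_all _ fun ω => ((G ω).continuous.tendsto _).comp (hf'.tendsto_approx ω))
  set s := hf'.approx n
  -- A simple function takes finitely many values, so `G` is only evaluated at fixed vectors, each
  -- on a measurable fiber.
  have h : (fun ω => G ω (s ω)) =
      fun ω => ∑ v ∈ s.range, (s ⁻¹' {v}).indicator (fun ω => G ω v) ω := by
    funext ω
    rw [Finset.sum_eq_single (s ω)]
    · simp
    · intro v _ hv
      exact indicator_of_notMem (fun h => hv h.symm) _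
    · exact fun h => absurd (s.mem_range_self ω) h
  rw [h]
  exact Finset.aestronglyMeasurable_fun_sum _ fun v _ => (hG v).indicator (s.measurableSet_fiber v)

variable {φ : Ω → M → M}

/-- Without a bounded extension `extendL1` takes its default value `0`, which kills the state `1`;
faithfulness therefore forces a genuine extension. -/
theorem exists_extension_of_isFaithful {f : M → M}
    (hf : IsFaithfulL1 τ (extendL1 τ f).toLinearMap) (a : M) :
    extendL1 τ f (ofM τ a) = ofM τ (f a) := by
  have h : ∃ g : L1 τ →L[ℂ] L1 τ, ∀ a : M, g (ofM τ a) = ofM τ (f a) := by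
    by_contra h
    have h0 : extendL1 τ f = 0 := dif_neg h
    have h1S := (ofM_one_mem_boundedStates (τ := τ)).1
    exact ne_zero_of_mem_states h1S (hf _ h1S.1 (by rw [h0]; rfl))
  obtain ⟨g, hg⟩ := h
  rw [extendL1_eq τ hg, hg]

theorem isPosFaithful_extendL1 {f : M → M} (hf : IsTauBoundedNormalPositive τ f)
    (h : IsFaithfulL1 τ (extendL1 τ f).toLinearMap) : IsPosFaithful τ (extendL1 τ f) := by
  refine ⟨fun x hx => ?_, h⟩
  refine posCone_induction (p := fun x => extendL1 τ f x ∈ posCone τ)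
    ((isClosed_posCone τ).preimage (extendL1 τ f).continuous) (fun a ha => ?_) hx
  rw [exists_extension_of_isFaithful h]
  exact ofM_mem_posCone (hf.nonneg a ha)

theorem aestronglyMeasurable_extendL1 [TopologicalSpace.SeparableSpace (L1 τ)]
    (hφ : IsWeakStarRandomLinearOperator τ P φ)
    (hφ_faithful : ∀ᵐ ω ∂P, IsFaithfulL1 τ (extendL1 τ (φ ω)).toLinearMap) (x : L1 τ) :
    AEStronglyMeasurable (fun ω => extendL1 τ (φ ω) x) P := by
  have h1 : ∀ a, AEStronglyMeasurable (fun ω => extendL1 τ (φ ω) (ofM τ a)) P := fun a => by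
    have h2 : StronglyMeasurable fun ω => ofM τ (φ ω a) := by
      refine stronglyMeasurable_of_pairing fun b => ?_
      have h3 := hφ.measurable a (ofM τ b)
      simp only [pairing_ofM] at h3 ⊢
      simpa only [τ.map_mul_comm' b] using h3
    refine h2.aestronglyMeasurable.congr ?_
    filter_upwards [hφ_faithful] with ω hω
    exact (exists_extension_of_isFaithful hω a).symm
  obtain ⟨u, hu, hux⟩ := mem_closure_iff_seq_limit.1 (denseRange_ofM τ x)
  choose a ha using hu
  obtain rfl : (fun n => ofM τ (a n)) = u := funext ha
  exact aestronglyMeasurable_of_tendsto_ae atTop (fun n => h1 (a n))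
    (ae_of_all _ fun ω => ((extendL1 τ (φ ω)).continuous.tendsto x).comp hux)

/-- Projective boundedness may be checked on a dense subset of the positive cone. -/
theorem isProjBounded_iff_of_dense (γ : L1 τ →L[ℂ] L1 τ) (c : ℝ) {D : Set (L1 τ)}
    (hDs : D ⊆ posCone τ) (hD : posCone τ ⊆ closure D) :
    IsProjBounded τ γ c ↔ ∀ x ∈ D, ∀ y ∈ D,
      ((c : ℂ) * tr τ (γ x)) • γ y - tr τ (γ y) • γ x ∈ posCone τ := by
  refine ⟨fun h x hx y hy => h x (hDs hx) y (hDs hy), fun h => ?_⟩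
  have hcont : Continuous fun z => tr τ (γ z) := (continuous_tr τ).comp γ.continuous
  have hcl : ∀ F : L1 τ → L1 τ, Continuous F → (∀ x ∈ D, F x ∈ posCone τ) →
      ∀ x ∈ posCone τ, F x ∈ posCone τ := fun F hF h x hx =>
    closure_minimal (t := F ⁻¹' posCone τ) h ((isClosed_posCone τ).preimage hF) (hD hx)
  have h1 : ∀ x ∈ D, ∀ y ∈ posCone τ,
      ((c : ℂ) * tr τ (γ x)) • γ y - tr τ (γ y) • γ x ∈ posCone τ := fun x hx => by
    refine hcl (fun y => ((c : ℂ) * tr τ (γ x)) • γ y - tr τ (γ y) • γ x) ?_ (h x hx)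
    exact Continuous.sub (((c : ℂ) * tr τ (γ x)) • γ).continuous (hcont.smul continuous_const)
  intro x hx y hy
  refine hcl (fun x => ((c : ℂ) * tr τ (γ x)) • γ y - tr τ (γ y) • γ x) ?_
    (fun x hx => h1 x hx y hy) x hx
  exact Continuous.sub ((continuous_const.mul hcont).smul continuous_const)
    (tr τ (γ y) • γ).continuous

/-- Projective boundedness is a measurable event. -/
theorem nullMeasurableSet_isProjBounded [TopologicalSpace.SeparableSpace (L1 τ)]
    {G : Ω → L1 τ →L[ℂ] L1 τ} (hG : ∀ x, AEStronglyMeasurable (fun ω => G ω x) P) (c : ℝ) :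
    NullMeasurableSet {ω | IsProjBounded τ (G ω) c} P := by
  have : SecondCountableTopology (L1 τ) := UniformSpace.secondCountable_of_separable _
  borelize (L1 τ)
  obtain ⟨D, hDs, hDc, hD⟩ :=
    (TopologicalSpace.IsSeparable.of_separableSpace (posCone τ)).exists_countable_dense_subset
  have h : {ω | IsProjBounded τ (G ω) c} = ⋂ x ∈ D, ⋂ y ∈ D,
      {ω | ((c : ℂ) * tr τ (G ω x)) • G ω y - tr τ (G ω y) • G ω x ∈ posCone τ} := by
    ext ω
    simp only [mem_ofPred_eq, mem_iInter]
    exact isProjBounded_iff_of_dense (G ω) c hDs hD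
  rw [h]
  refine .biInter hDc fun x _ => .biInter hDc fun y _ => ?_
  have htr : ∀ x, AEStronglyMeasurable (fun ω => tr τ (G ω x)) P := fun x =>
    (continuous_tr τ).comp_aestronglyMeasurable (hG x)
  exact (((((htr x).const_mul _).smul (hG y)).sub ((htr y).smul (hG x))).aemeasurable).nullMeasurable
    (isClosed_posCone τ).measurableSet

theorem aestronglyMeasurable_proj {G : Ω → L1 τ →L[ℂ] L1 τ} {x : L1 τ}
    (hG : AEStronglyMeasurable (fun ω => G ω x) P) :
    AEStronglyMeasurable (fun ω => proj τ (G ω).toLinearMap x) P :=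
  ((continuous_tr τ).comp_aestronglyMeasurable hG).aemeasurable.inv.aestronglyMeasurable.smul hG

end measurability

end TracialVN

namespace TracialVN

/-! ### Recurrence along almost every orbit. -/

section dynamics

open Filter Topology MeasureTheory Set

variable {Ω : Type*} [MeasurableSpace Ω] {P : Measure Ω} {T : Ω ≃ᵐ Ω}

theorem measurePreserving_zpow (hT : MeasurePreserving T P P) (j : ℤ) :
    MeasurePreserving (T.toEquiv ^ j : Equiv.Perm Ω) P P := by
  induction j with
  | zero => exact MeasurePreserving.id P
  | succ i ih =>
    rw [zpow_add_one, Equiv.Perm.coe_mul]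
    exact ih.comp hT
  | pred i ih =>
    rw [zpow_sub_one, Equiv.Perm.coe_mul]
    exact ih.comp hT.symm

/-- Almost every backward orbit visits a set of positive measure infinitely often. -/
theorem ae_forall_exists_zpow_mem [IsProbabilityMeasure P] (hT : Ergodic T P) {B : Set Ω}
    (hB : NullMeasurableSet B P) (hB0 : P B ≠ 0) :
    ∀ᵐ ω ∂P, ∀ n : ℤ, ∃ j ≤ n, (T.toEquiv ^ j : Equiv.Perm Ω) ω ∈ B := by
  obtain ⟨B', hB'B, hB', hB'eq⟩ := hB.exists_measurable_subset_ae_eq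
  set R : Set Ω := {ω | ∃ᶠ k : ℕ in atTop, T.symm^[k] ω ∈ B'} with hR
  have hRm : MeasurableSet R := by
    simp only [hR, frequently_atTop, ofPred_forall, ofPred_exists, ← exists_prop]
    refine .iInter fun a => .iUnion fun b => ?_
    refine MeasurableSet.iUnion fun _ => ?_
    exact (T.symm.measurable.iterate b) hB'
  have hRinv : T.symm ⁻¹' R = R := by
    ext ω
    simp only [hR, mem_preimage, mem_ofPred_eq, ← Function.iterate_succ_apply]
    rw [← Filter.frequently_map (m := fun k : ℕ => k + 1)
      (P := fun k => T.symm^[k] ω ∈ B'), map_add_atTop_eq_nat]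
  have hRae : ∀ᵐ ω ∂P, ω ∈ R := by
    -- By ergodicity the invariant set `R` is null or conull. Poincaré recurrence puts almost every
    -- point of `B'` in `R`, so a null `R` would make `B` null.
    refine (hT.symm.toPreErgodic.ae_mem_or_ae_notMem hRm hRinv).resolve_right fun h => ?_
    have h1 := hT.symm.toMeasurePreserving.conservative.ae_mem_imp_frequently_image_mem
      hB'.nullMeasurableSet
    refine hB0 ((measure_congr hB'eq).symm.trans (measure_eq_zero_iff_ae_notMem.2 ?_))
    filter_upwards [h, h1] with ω h2 h3 h4
    exact h2 (h3 h4)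
  filter_upwards [hRae] with ω hω n
  obtain ⟨k, hk, hk'⟩ := frequently_atTop.1 hω n.natAbs
  refine ⟨-k, by omega, hB'B ?_⟩
  have : (T.toEquiv ^ (-k : ℤ) : Equiv.Perm Ω) = T.toEquiv⁻¹ ^ k := by simp
  rw [this, ← Equiv.Perm.iterate_eq_pow]
  exact hk'

variable {H : Type*} [NormedAddCommGroup H] [InnerProductSpace ℂ H] [CompleteSpace H]
  {M : VonNeumannAlgebra H} {τ : TracialState M}

variable (τ) in
/-- The sequence `i ↦ φ_{T^i ω}` of extended maps along the orbit of `ω`. -/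
noncomputable def orbitMaps (φ : Ω → M → M) (T : Ω ≃ᵐ Ω) (ω : Ω) (i : ℤ) : L1 τ →L[ℂ] L1 τ :=
  extendL1 τ (φ ((T.toEquiv ^ i : Equiv.Perm Ω) ω))

variable {φ : Ω → M → M}

theorem orbitMaps_zpow (ω : Ω) (j : ℤ) :
    orbitMaps τ φ T ((T.toEquiv ^ j : Equiv.Perm Ω) ω) = fun i => orbitMaps τ φ T ω (i + j) := by
  funext i
  rw [orbitMaps, orbitMaps, zpow_add, Equiv.Perm.mul_apply]

/-- `iterComp` counts compositions whereas `seqComp` counts factors, hence the shift by one. -/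
theorem iterComp_eq_seqComp (ω : Ω) (m : ℤ) (k : ℕ) :
    iterComp (fun ω => extendL1 τ (φ ω)) T m k ω = seqComp (orbitMaps τ φ T ω) m (k + 1) := by
  induction k with
  | zero =>
    simp only [iterComp, seqComp, orbitMaps]
    simp
  | succ k ih => rw [iterComp, ih]; rfl

theorem process_eq_intervalComp (ω : Ω) {n m : ℤ} (h : m ≤ n) :
    process τ φ T n m ω = intervalComp (orbitMaps τ φ T ω) n m := by
  rw [process, iterComp_eq_seqComp, intervalComp]
  congr 1
  omega

theorem aestronglyMeasurable_seqComp [TopologicalSpace.SeparableSpace (L1 τ)]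
    (hT : MeasurePreserving T P P) (hφ : IsWeakStarRandomLinearOperator τ P φ)
    (hφ_faithful : ∀ᵐ ω ∂P, IsFaithfulL1 τ (extendL1 τ (φ ω)).toLinearMap)
    (m : ℤ) (k : ℕ) (x : L1 τ) :
    AEStronglyMeasurable (fun ω => seqComp (orbitMaps τ φ T ω) m k x) P := by
  induction k with
  | zero => exact aestronglyMeasurable_const
  | succ k ih =>
    exact aestronglyMeasurable_clm_apply (G := fun ω => orbitMaps τ φ T ω (m + k))
      (fun x => (aestronglyMeasurable_extendL1 hφ hφ_faithful x).comp_measurePreserving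
        (measurePreserving_zpow hT (m + k))) ih

/-- Along almost every orbit a projectively bounded block of fixed length recurs. -/
theorem exists_ae_recurring_block [IsProbabilityMeasure P]
    [TopologicalSpace.SeparableSpace (L1 τ)] (hT : Ergodic T P)
    (hφ : IsWeakStarRandomLinearOperator τ P φ)
    (hφ_faithful : ∀ᵐ ω ∂P, IsFaithfulL1 τ (extendL1 τ (φ ω)).toLinearMap)
    (hSHC : 0 < P {ω | ∃ n m : ℤ, m ≤ n ∧ IsSHC τ (process τ φ T n m ω).toLinearMap}) :
    ∃ (c : ℝ) (k : ℕ), 1 ≤ c ∧ ∀ᵐ ω ∂P, ∀ n : ℤ, ∃ j ≤ n,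
      IsProjBounded τ (seqComp (orbitMaps τ φ T ω) j k) c := by
  have hshift : ∀ (ω : Ω) (j : ℤ) (k : ℕ), seqComp (orbitMaps τ φ T ω) j k =
      seqComp (orbitMaps τ φ T ((T.toEquiv ^ j : Equiv.Perm Ω) ω)) 0 k := fun ω j k => by
    rw [orbitMaps_zpow, seqComp_shift, zero_add]
  let B : ℕ → ℕ → Set Ω := fun k c =>
    {ω | IsProjBounded τ (seqComp (orbitMaps τ φ T ω) 0 k) ((c : ℝ) + 1)}
  have hBm : ∀ k c, NullMeasurableSet (B k c) P := fun k c =>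
    nullMeasurableSet_isProjBounded
      (fun x => aestronglyMeasurable_seqComp hT.toMeasurePreserving hφ hφ_faithful 0 k x) _
  obtain ⟨k, c, hkc⟩ : ∃ k c, P (B k c) ≠ 0 := by
    by_contra! h
    -- Start, length and integer-rounded constant range over countable sets, and translation by `T ^
    -- m` preserves the measure of each `B k c`. If all were null, so would be the event in the
    -- hypothesis.
    refine hSHC.ne' (measure_mono_null (t := ⋃ (m : ℤ) (k : ℕ) (c : ℕ),
      (T.toEquiv ^ m : Equiv.Perm Ω) ⁻¹' B k c) ?_ ?_)
    · rintro ω ⟨n, m, hmn, hω⟩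
      obtain ⟨c, -, hc⟩ := exists_isProjBounded_of_isSHC hω
      obtain ⟨N, hN⟩ := exists_nat_ge c
      simp only [mem_iUnion]
      refine ⟨m, (n + 1 - m).toNat, N, ?_⟩
      have h1 := hc.mono ⟨hω.1, hω.2.1⟩ (hN.trans (by linarith : (N : ℝ) ≤ N + 1))
      rw [process_eq_intervalComp ω hmn, intervalComp, hshift] at h1
      exact h1
    · refine measure_iUnion_null fun m => measure_iUnion_null fun k => measure_iUnion_null fun c => ?_
      rw [(measurePreserving_zpow hT.toMeasurePreserving m).measure_preimage (hBm k c), h k c]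
  refine ⟨(c : ℝ) + 1, k, by simp, ?_⟩
  filter_upwards [ae_forall_exists_zpow_mem hT (hBm k c) hkc] with ω hω n
  obtain ⟨j, hj, h⟩ := hω n
  refine ⟨j, hj, ?_⟩
  rw [hshift]
  exact h

end dynamics

end TracialVN

/-! ### Construction of the equivariant limit states. -/

open MeasureTheory Filter Topology TracialVN in
theorem mainTheorem10 {H : Type*} [NormedAddCommGroup H] [InnerProductSpace ℂ H] [CompleteSpace H]
    (M : VonNeumannAlgebra H) (τ : TracialState M)
    (hsep : TopologicalSpace.SeparableSpace (L1 τ))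
    {Ω : Type*} [MeasurableSpace Ω] (P : Measure Ω) [IsProbabilityMeasure P]
    (T : Ω ≃ᵐ Ω) (hT : Ergodic T P)
    (φ : Ω → M → M)
    (hφ : IsWeakStarRandomLinearOperator τ P φ)
    (hφ_prop : ∀ᵐ ω ∂P, IsTauBoundedNormalPositive τ (φ ω))
    (hφ_faithful : ∀ᵐ ω ∂P, IsFaithfulL1 τ (extendL1 τ (φ ω)).toLinearMap)
    (hSHC : 0 < P {ω | ∃ n m : ℤ, m ≤ n ∧ IsSHC τ (process τ φ T n m ω).toLinearMap}) :
    ∃ A : ℤ → Ω → L1 τ,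
      (∀ n, StronglyMeasurable (A n)) ∧
      (∀ n ω, A n ω ∈ boundedStates τ) ∧
      (∀ᵐ ω ∂P, ∀ n : ℤ,
        proj τ (extendL1 τ (φ ((T.toEquiv ^ (n + 1) : Equiv.Perm Ω) ω))).toLinearMap (A n ω)
            = A (n + 1) ω ∧
          A n (T ω) = A (n + 1) ω ∧ A n (T.symm ω) = A (n - 1) ω) ∧
      (∀ x ∈ states τ, ∀ᵐ ω ∂P, ∀ n : ℤ,
        Tendsto (fun m : ℤ => ‖proj τ (process τ φ T n m ω).toLinearMap x - A n ω‖)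
          atBot (𝓝 0)) ∧
      (∀ x ∈ boundedStates τ, ∀ᵐ ω ∂P, ∀ n : ℤ,
        Tendsto (fun m : ℤ => opNorm τ (proj τ (process τ φ T n m ω).toLinearMap x - A n ω))
          atBot (𝓝 0)) := by
  have hTm := hT.toMeasurePreserving
  obtain ⟨c, k, hc, hgood⟩ := exists_ae_recurring_block hT hφ hφ_faithful hSHC
  have hpf : ∀ᵐ ω ∂P, ∀ i, IsPosFaithful τ (orbitMaps τ φ T ω i) := ae_all_iff.2 fun i => by
    refine (measurePreserving_zpow hTm i).quasiMeasurePreserving.ae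
      (p := fun ω => IsPosFaithful τ (extendL1 τ (φ ω))) ?_
    filter_upwards [hφ_prop, hφ_faithful] with ω h1 h2
    exact isPosFaithful_extendL1 h1 h2
  have hM : ∀ᵐ ω ∂P, ∀ i a, ∃ b : M, orbitMaps τ φ T ω i (ofM τ a) = ofM τ b :=
    ae_all_iff.2 fun i => by
      refine (measurePreserving_zpow hTm i).quasiMeasurePreserving.ae
        (p := fun ω => ∀ a, ∃ b : M, extendL1 τ (φ ω) (ofM τ a) = ofM τ b) ?_
      filter_upwards [hφ_faithful] with ω h a
      exact ⟨_, exists_extension_of_isFaithful h a⟩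
  -- The limit is chosen for every `ω`, with the default state `1` off the good event, so that the
  -- values are bounded states everywhere.
  have hlim : ∀ ω n, ∃ z ∈ boundedStates τ, ((∀ i, IsPosFaithful τ (orbitMaps τ φ T ω i)) →
      (∀ i a, ∃ b : M, orbitMaps τ φ T ω i (ofM τ a) = ofM τ b) →
      (∀ n : ℤ, ∃ j ≤ n, IsProjBounded τ (seqComp (orbitMaps τ φ T ω) j k) c) →
      (∀ x ∈ states τ, Tendsto (fun m : ℤ =>
        proj τ (intervalComp (orbitMaps τ φ T ω) n m).toLinearMap x) atBot (𝓝 z)) ∧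
      ∀ x ∈ boundedStates τ, Tendsto (fun m : ℤ =>
        opNorm τ (proj τ (intervalComp (orbitMaps τ φ T ω) n m).toLinearMap x - z))
          atBot (𝓝 0)) := fun ω n => by
    by_cases h : (∀ i, IsPosFaithful τ (orbitMaps τ φ T ω i)) ∧
      (∀ i a, ∃ b : M, orbitMaps τ φ T ω i (ofM τ a) = ofM τ b) ∧
      ∀ n : ℤ, ∃ j ≤ n, IsProjBounded τ (seqComp (orbitMaps τ φ T ω) j k) c
    · obtain ⟨z, hz, h'⟩ := exists_tendsto_intervalComp h.1 h.2.1 hc h.2.2 n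
      exact ⟨z, hz, fun _ _ _ => h'⟩
    · exact ⟨ofM τ 1, ofM_one_mem_boundedStates, fun h1 h2 h3 => absurd ⟨h1, h2, h3⟩ h⟩
  choose Z hZS hZ using hlim
  have hZ' : ∀ᵐ ω ∂P, ∀ n, (∀ x ∈ states τ, Tendsto (fun m : ℤ =>
        proj τ (intervalComp (orbitMaps τ φ T ω) n m).toLinearMap x) atBot (𝓝 (Z ω n))) ∧
      ∀ x ∈ boundedStates τ, Tendsto (fun m : ℤ =>
        opNorm τ (proj τ (intervalComp (orbitMaps τ φ T ω) n m).toLinearMap x - Z ω n))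
          atBot (𝓝 0) := by
    filter_upwards [hpf, hM, hgood] with ω h1 h2 h3 n
    exact hZ ω n h1 h2 h3
  have h1S := (ofM_one_mem_boundedStates (τ := τ)).1
  have hZm : ∀ n, AEStronglyMeasurable (fun ω => Z ω n) P := fun n => by
    refine aestronglyMeasurable_of_tendsto_ae (u := (atBot : Filter ℤ))
      (fun m => aestronglyMeasurable_proj (G := fun ω => intervalComp (orbitMaps τ φ T ω) n m)
        (x := ofM τ 1) (aestronglyMeasurable_seqComp hTm hφ hφ_faithful _ _ _)) ?_
    filter_upwards [hZ'] with ω h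
    exact (h n).1 _ h1S
  obtain ⟨N, hN, hNm, hN0⟩ := exists_measurable_superset_of_null
    (ae_iff.1 (ae_all_iff.2 fun n => (hZm n).ae_eq_mk))
  classical
  -- Off `N` the measurable versions agree with `Z` for all `n` at once. Resetting them to `1` on
  -- the measurable null set `N` gives strong measurability and values in `S_b` at every `ω`.
  set A : ℤ → Ω → L1 τ := fun n => N.piecewise (fun _ => ofM τ 1) (hZm n).mk with hA
  have hAZ : ∀ ω ∉ N, ∀ n, A n ω = Z ω n := fun ω hω n => by
    rw [hA]
    change N.piecewise _ _ ω = _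
    rw [Set.piecewise_eq_of_notMem _ _ _ hω]
    by_contra h
    exact hω (hN fun h' => h (h' n).symm)
  have hAZae : ∀ᵐ ω ∂P, ∀ n, A n ω = Z ω n :=
    (measure_eq_zero_iff_ae_notMem.1 hN0).mono hAZ
  have hstep : ∀ᵐ ω ∂P, ∀ n, A n (T ω) = A (n + 1) ω := by
    filter_upwards [hAZae, hZ', hTm.quasiMeasurePreserving.ae hAZae,
      hTm.quasiMeasurePreserving.ae hZ'] with ω h1 h2 h3 h4 n
    rw [h1, h3]
    have hT1 : orbitMaps τ φ T (T ω) = fun i => orbitMaps τ φ T ω (i + 1) := by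
      rw [← orbitMaps_zpow, zpow_one]
      rfl
    have h5 := (h4 n).1 _ h1S
    simp only [hT1, intervalComp_shift] at h5
    -- The products along the orbit of `T ω` over `[m, n]` are those of `ω` over `[m + 1, n + 1]`.
    exact tendsto_nhds_unique h5
      (((h2 (n + 1)).1 _ h1S).comp (tendsto_atBot_add_const_right _ 1 tendsto_id))
  have hproc : ∀ ω n, ∀ᶠ m : ℤ in atBot,
      intervalComp (orbitMaps τ φ T ω) n m = process τ φ T n m ω := fun ω n => by
    filter_upwards [Iic_mem_atBot n] with m hm
    exact (process_eq_intervalComp ω hm).symm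
  refine ⟨A, fun n => (stronglyMeasurable_const.piecewise hNm (hZm n).stronglyMeasurable_mk),
    fun n ω => ?_, ?_, fun x hx => ?_, fun x hx => ?_⟩
  · by_cases hω : ω ∈ N
    · have h1 : A n ω = ofM τ 1 := Set.piecewise_eq_of_mem _ _ _ hω
      rw [h1]
      exact ofM_one_mem_boundedStates
    · rw [hAZ ω hω]
      exact hZS ω n
  · filter_upwards [hpf, hAZae, hZ', hstep, hTm.symm.quasiMeasurePreserving.ae hstep]
      with ω h1 h2 h3 h4 h5 n
    refine ⟨?_, h4 n, ?_⟩
    · rw [h2, h2]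
      exact proj_eq_of_tendsto h1 h1S (hZS ω n).1 ((h3 n).1 _ h1S) ((h3 (n + 1)).1 _ h1S)
    · have := h5 (n - 1)
      rw [sub_add_cancel, MeasurableEquiv.apply_symm_apply] at this
      exact this.symm
  · filter_upwards [hAZae, hZ'] with ω h1 h2 n
    rw [h1]
    refine (tendsto_iff_norm_sub_tendsto_zero.1 ((h2 n).1 x hx)).congr' ?_
    filter_upwards [hproc ω n] with m hm
    rw [hm]
  · filter_upwards [hAZae, hZ'] with ω h1 h2 n
    rw [h1]
    refine ((h2 n).2 x hx).congr' ?_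
    filter_upwards [hproc ω n] with m hm
    rw [hm]
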